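/- Let $k$ be a field of characteristic $0$. All dg vector spaces are $\mathbb Z$-graded over $k$ with a differential of degree $+1$, and all signs are Koszul signs. Cyclic operads and dioperads are symmetric operads in dg vector spaces without units: a cyclic operad $O$ has a dg vector space $O((n))$ with an action of $S_n$ for every $n\ge 0$, and equivariant, associative compositions that glue a flag of one operation to a flag of another one; a dioperad $P$ has dg vector spaces $P(r,s)$ of operations with $r\ge 0$ outputs and $s\ge 0$ inputs, with an action of $S_r\times S_s$, and equivariant, associative compositions that glue one output to one input (empty sets of inputs or outputs are allowed). For a dioperad $P$ let $L^!(P)$ be the cyclic operad $$L^!(P)((n))=\bigoplus_{r+s=n}P(r,s)\otimes_{k[S_r\times S_s]}k[S_n],$$ that is, the direct sum, over all choices of a direction (input or output) for each of the $n$ flags, of the corresponding spaces of operations of $P$; a composition of cyclic operations along an edge is the composition of $P$ on the summands in which the two glued flags have opposite directions, and it is $0$ on the summands in which they have the same direction. This is a functor $L^!$ from dioperads to cyclic operads, associated with the morphism of Feynman categories that forgets directions. Its left adjoint is denoted by $R^!$. Let $A$ be a dg vector space of finite type (every homogeneous component is finite dimensional), let $A^*$ be its graded dual, and let $\mathsf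 d(A)=A\oplus A^*$ with the non-degenerate graded symmetric form $$\langle a\oplus\eta,\,b\oplus\xi\rangle=\eta(b)+(-1)^{|a||\xi|}\,\xi(a).$$ Let $End^{di}_A$ be the endomorphism dioperad of $A$, $End^{di}_A(r,s)=A^{\otimes r}\otimes(A^*)^{\otimes s}$, in which an output is composed with an input by evaluation, and let $End^{cyc}_{(V,B)}$ be the endomorphism cyclic operad of a dg vector space $V$ with a non-degenerate symmetric form $B$, $End^{cyc}_{(V,B)}((n))=V^{\otimes n}$, in which two flags are composed by contraction with $B$. For a dioperad $P$, a $P$-algebra structure on $A$ is a morphism of dioperads $P\to End^{di}_A$; for a cyclic operad $O$, an $O$-algebra structure on $(V,B)$ is a morphism of cyclic operads $O\to End^{cyc}_{(V,B)}$. Then: 1. There is an isomorphism of cyclic operads $e\colon L^!(End^{di}_A)\cong End^{cyc}_{(\mathsf d(A),\langle-,-\rangle)}$. 2. The left adjoint $R^!$ of $L^!$ exists, and for every cyclic operad $O$ the map that sends a morphism $\alpha\colon R^!(O)\to End^{di}_A$ to the composite of its adjoint $O\to L^!(End^{di}_A)$ with $e$ is a bijection, natural in $O$, from the $R^!(O)$-algebra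 structures on $A$ to the $O$-algebra structures on $(\mathsf d(A),\langle-,-\rangle)$. -/

import Mathlib

open CategoryTheory
open scoped TensorProduct

universe u

/-- A differential graded vector space over `k`: a vector space with an internal `ℤ`-grading and a
square-zero differential of degree `1`. -/
structure DGVect (k : Type u) [Field k] where
  carrier : Type u
  [addCommGroup : AddCommGroup carrier]
  [module : Module k carrier]
  /-- the homogeneous components -/
  gr : ℤ → Submodule k carrier
  isInternal : DirectSum.IsInternal gr
  /-- the differential -/
  d : carrier →ₗ[k] carrier
  d_mem : ∀ {p : ℤ} {x : carrier}, x ∈ gr p → d x ∈ gr (p + 1)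
  d_d : ∀ x, d (d x) = 0

namespace DGVect

variable {k : Type u} [Field k]

instance : CoeSort (DGVect k) (Type u) := ⟨DGVect.carrier⟩

attribute [instance] DGVect.addCommGroup DGVect.module

/-- Finite type: every homogeneous component is finite dimensional. -/
def IsFiniteType (V : DGVect k) : Prop := ∀ p : ℤ, FiniteDimensional k (V.gr p)

/-- The operator that multiplies the component of degree `p` by the scalar `f p`. -/
noncomputable def scale (V : DGVect k) (f : ℤ → k) : V →ₗ[k] V :=
  (DirectSum.toModule k ℤ V.carrier fun p => f p • (V.gr p).subtype) ∘ₗ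
    (LinearEquiv.ofBijective (DirectSum.coeLinearMap V.gr) V.isInternal).symm.toLinearMap

theorem scale_of_mem (V : DGVect k) (f : ℤ → k) {p : ℤ} {x : V} (hx : x ∈ V.gr p) :
    V.scale f x = f p • x := by
  have h : (LinearEquiv.ofBijective (DirectSum.coeLinearMap V.gr) V.isInternal).symm x
      = DirectSum.lof k ℤ (fun p => V.gr p) p ⟨x, hx⟩ :=
    (LinearEquiv.symm_apply_eq _).2 (DirectSum.coeLinearMap_of V.gr p ⟨x, hx⟩).symm
  rw [scale, LinearMap.comp_apply, LinearEquiv.coe_coe, h, DirectSum.toModule_lof]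
  rfl

/-- Two linear maps that agree on homogeneous vectors are equal. -/
theorem hom_ext (V : DGVect k) {M : Type*} [AddCommGroup M] [Module k M] {f g : V →ₗ[k] M}
    (h : ∀ p, ∀ x ∈ V.gr p, f x = g x) : f = g := by
  have htop := V.isInternal.submodule_iSup_eq_top
  have : (⊤ : Submodule k V) ≤ LinearMap.eqLocus f g := by
    rw [← htop]
    exact iSup_le fun p x hx => h p x hx
  ext x
  exact this (Submodule.mem_top : x ∈ ⊤)

/-- The Koszul sign operator `x ↦ (-1)^|x| x`. -/
noncomputable def eps (V : DGVect k) : V →ₗ[k] V := V.scale fun p => (-1) ^ p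

theorem eps_of_mem (V : DGVect k) {p : ℤ} {x : V} (hx : x ∈ V.gr p) :
    V.eps x = (-1 : k) ^ p • x :=
  scale_of_mem V _ hx

theorem eps_mem (V : DGVect k) {p : ℤ} {x : V} (hx : x ∈ V.gr p) : V.eps x ∈ V.gr p := by
  rw [eps_of_mem V hx]
  exact Submodule.smul_mem _ _ hx

theorem d_eps (V : DGVect k) (x : V) : V.d (V.eps x) = - V.eps (V.d x) := by
  have : V.d ∘ₗ V.eps = - (V.eps ∘ₗ V.d) := by
    apply V.hom_ext
    intro p x hx
    simp [V.eps_of_mem hx, V.eps_of_mem (V.d_mem hx), zpow_add_one₀]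
  exact LinearMap.congr_fun this x

/-- The projection onto the component of degree `q`. -/
noncomputable def proj (V : DGVect k) (q : ℤ) : V →ₗ[k] V := V.scale fun p => if p = q then 1 else 0

theorem proj_of_mem (V : DGVect k) {p : ℤ} {x : V} (hx : x ∈ V.gr p) : V.proj p x = x := by
  rw [proj, scale_of_mem V _ hx]; simp

theorem proj_of_mem_ne (V : DGVect k) {p q : ℤ} {x : V} (hx : x ∈ V.gr p) (h : p ≠ q) :
    V.proj q x = 0 := by
  rw [proj, scale_of_mem V _ hx]; simp [h]

/-- A criterion for a family of subspaces to be a grading. -/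
theorem isInternal_of_proj {M : Type*} [AddCommGroup M] [Module k M] (g : ℤ → Submodule k M)
    (π : ℤ → M →ₗ[k] M) (h1 : ∀ p, ∀ x ∈ g p, π p x = x)
    (h2 : ∀ p q, p ≠ q → ∀ x ∈ g p, π q x = 0) (h3 : ⨆ p, g p = ⊤) :
    DirectSum.IsInternal g := by
  rw [DirectSum.isInternal_submodule_iff_iSupIndep_and_iSup_eq_top]
  refine ⟨fun p => ?_, h3⟩
  rw [Submodule.disjoint_def]
  intro x hx hx'
  rw [← h1 p x hx]
  have : (⨆ j, ⨆ (_ : j ≠ p), g j) ≤ LinearMap.ker (π p) :=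
    iSup_le fun j => iSup_le fun hj y hy => h2 j p hj y hy
  exact this hx'

/-- The product (equivalently, the direct sum) of a finite family of dg vector spaces. -/
noncomputable def pi {ι : Type} [Finite ι] (V : ι → DGVect k) : DGVect k where
  carrier := ∀ i, V i
  gr p := Submodule.pi Set.univ fun i => (V i).gr p
  isInternal := by
    classical
    have := Fintype.ofFinite ι
    refine isInternal_of_proj _ (fun q => LinearMap.pi fun i => (V i).proj q ∘ₗ LinearMap.proj i)
      ?_ ?_ ?_
    · intro p x hx
      ext i
      exact (V i).proj_of_mem (hx i trivial)
    · intro p q hpq x hx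
      ext i
      exact (V i).proj_of_mem_ne (hx i trivial) hpq
    · rw [eq_top_iff]
      intro x _
      have hx : x = ∑ i, LinearMap.single k (fun i => (V i).carrier) i (x i) :=
        (Finset.univ_sum_single x).symm
      rw [hx]
      refine Submodule.sum_mem _ fun i _ => ?_
      have hle : (⊤ : Submodule k (V i)) ≤
          (⨆ p, Submodule.pi Set.univ fun i => (V i).gr p).comap
            (LinearMap.single k (fun i => (V i).carrier) i) := by
        rw [← (V i).isInternal.submodule_iSup_eq_top]
        refine iSup_le fun p y hy => Submodule.mem_comap.2 (Submodule.mem_iSup_of_mem p ?_)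
        intro j _
        by_cases hj : j = i
        · subst hj
          rw [LinearMap.single_apply, Pi.single_eq_same]
          exact hy
        · rw [LinearMap.single_apply, Pi.single_eq_of_ne hj]
          exact Submodule.zero_mem _
      exact Submodule.mem_comap.1 (hle Submodule.mem_top)
  d := LinearMap.pi fun i => (V i).d ∘ₗ LinearMap.proj i
  d_mem := fun hx i _ => (V i).d_mem (hx i trivial)
  d_d := fun x => funext fun i => (V i).d_d (x i)

/-- The functionals that vanish outside degree `-p`. -/
def dualGr (A : DGVect k) (p : ℤ) : Submodule k (A →ₗ[k] k) where
  carrier := {η | ∀ q, q + p ≠ 0 → ∀ x ∈ A.gr q, η x = 0}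
  add_mem' := fun {a b} ha hb q hq x hx => by
    simp [ha q hq x hx, hb q hq x hx]
  zero_mem' := fun q hq x hx => rfl
  smul_mem' := fun c η h q hq x hx => by simp [h q hq x hx]

theorem d_dual_mem (A : DGVect k) {p : ℤ} {η : A →ₗ[k] k} (h : η ∈ A.dualGr p) :
    η ∘ₗ A.d ∘ₗ A.eps ∈ A.dualGr (p + 1) := by
  intro q hq x hx
  exact h (q + 1) (by omega) _ (A.d_mem (A.eps_mem hx))

/-- The underlying vector space of the graded dual: the functionals that vanish on all but finitely
many homogeneous components. -/
def dualSpace (A : DGVect k) : Submodule k (A →ₗ[k] k) := ⨆ p, A.dualGr p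

/-- The underlying type of the graded dual. -/
def DualCarrier (A : DGVect k) : Type u := A.dualSpace

noncomputable instance (A : DGVect k) : AddCommGroup A.DualCarrier :=
  inferInstanceAs (AddCommGroup A.dualSpace)

noncomputable instance (A : DGVect k) : Module k A.DualCarrier :=
  inferInstanceAs (Module k A.dualSpace)

/-- The inclusion of the graded dual in the space of all functionals. -/
def dualIncl (A : DGVect k) : A.DualCarrier →ₗ[k] (A →ₗ[k] k) := A.dualSpace.subtype

theorem dualIncl_injective (A : DGVect k) : Function.Injective A.dualIncl :=
  Subtype.val_injective

theorem dualGr_le (A : DGVect k) (p : ℤ) : A.dualGr p ≤ A.dualSpace := le_iSup A.dualGr p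

theorem dualSpace_le_comap (A : DGVect k) (f : A →ₗ[k] A) (s : ℤ → ℤ)
    (h : ∀ p, ∀ η ∈ A.dualGr p, η ∘ₗ f ∈ A.dualGr (s p)) :
    ∀ η ∈ A.dualSpace, LinearMap.lcomp k k f η ∈ A.dualSpace := by
  have hle : A.dualSpace ≤ A.dualSpace.comap (LinearMap.lcomp k k f) :=
    iSup_le fun p η hη => A.dualGr_le (s p) (h p η hη)
  exact fun η hη => hle hη

/-- Precomposition with an endomorphism, on the graded dual. -/
def dualMap (A : DGVect k) (f : A →ₗ[k] A) (s : ℤ → ℤ)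
    (h : ∀ p, ∀ η ∈ A.dualGr p, η ∘ₗ f ∈ A.dualGr (s p)) : A.DualCarrier →ₗ[k] A.DualCarrier :=
  (LinearMap.lcomp k k f).restrict (A.dualSpace_le_comap f s h)

theorem dualMap_apply (A : DGVect k) (f : A →ₗ[k] A) (s : ℤ → ℤ)
    (h : ∀ p, ∀ η ∈ A.dualGr p, η ∘ₗ f ∈ A.dualGr (s p)) (η : A.DualCarrier) (x : A) :
    A.dualIncl (A.dualMap f s h η) x = A.dualIncl η (f x) := rfl

theorem dual_ext (A : DGVect k) {η ξ : A.DualCarrier}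
    (h : ∀ p, ∀ x ∈ A.gr p, A.dualIncl η x = A.dualIncl ξ x) : η = ξ :=
  A.dualIncl_injective (A.hom_ext h)

theorem proj_dual_mem (A : DGVect k) (q p : ℤ) (η : A →ₗ[k] k) (h : η ∈ A.dualGr p) :
    η ∘ₗ A.proj (-q) ∈ A.dualGr p := by
  intro r hr x hx
  rw [LinearMap.comp_apply]
  by_cases hq : r = -q
  · subst hq
    rw [A.proj_of_mem hx]
    exact h _ hr x hx
  · rw [A.proj_of_mem_ne hx hq, map_zero]

theorem dual_isInternal (A : DGVect k) :
    DirectSum.IsInternal fun p => (A.dualGr p).comap A.dualIncl := by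
  refine isInternal_of_proj _ (fun q => A.dualMap (A.proj (-q)) id (A.proj_dual_mem q)) ?_ ?_ ?_
  · intro p η hη
    refine A.dual_ext fun q x hx => ?_
    rw [dualMap_apply]
    by_cases h : q = -p
    · subst h; rw [A.proj_of_mem hx]
    · rw [A.proj_of_mem_ne hx h, map_zero]
      exact (hη q (by omega) x hx).symm
  · intro p q hpq η hη
    refine A.dual_ext fun r x hx => ?_
    rw [dualMap_apply]
    by_cases h : r = -q
    · subst h; rw [A.proj_of_mem hx]
      exact hη (-q) (by omega) x hx
    · rw [A.proj_of_mem_ne hx h, map_zero, map_zero, LinearMap.zero_apply]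
  · apply Submodule.map_injective_of_injective A.dualIncl_injective
    have hr : LinearMap.range A.dualIncl = A.dualSpace := A.dualSpace.range_subtype
    rw [Submodule.map_iSup, Submodule.map_top, hr]
    simp only [Submodule.map_comap_eq, hr]
    refine le_antisymm (iSup_le fun p => inf_le_left) (iSup_le fun p => ?_)
    exact le_iSup_of_le p (le_inf (A.dualGr_le p) le_rfl)

/-- The graded linear dual of `A`. A functional concentrated on the component of degree `-p` has
degree `p`, and the differential is `(dη)(x) = -(-1)^|η| η(dx)`, which equals `(-1)^|x| η(dx)`. -/
noncomputable def dual (A : DGVect k) : DGVect k where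
  carrier := A.DualCarrier
  gr p := (A.dualGr p).comap A.dualIncl
  isInternal := A.dual_isInternal
  d := A.dualMap (A.d ∘ₗ A.eps) (· + 1) fun _ _ h => A.d_dual_mem h
  d_mem := fun hx => A.d_dual_mem hx
  d_d := fun η => by
    refine A.dual_ext fun p x _ => ?_
    rw [dualMap_apply, dualMap_apply]
    simp [A.d_eps, A.d_d]

/-- The direct sum of two dg vector spaces. -/
noncomputable def prod (V W : DGVect k) : DGVect k where
  carrier := V × W
  gr p := (V.gr p).prod (W.gr p)
  isInternal := by
    refine isInternal_of_proj _ (fun q => (V.proj q).prodMap (W.proj q)) ?_ ?_ ?_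
    · rintro p ⟨x, y⟩ ⟨hx, hy⟩
      exact Prod.ext (V.proj_of_mem hx) (W.proj_of_mem hy)
    · rintro p q hpq ⟨x, y⟩ ⟨hx, hy⟩
      exact Prod.ext (V.proj_of_mem_ne hx hpq) (W.proj_of_mem_ne hy hpq)
    · rw [eq_top_iff]
      rintro ⟨x, y⟩ -
      have h1 : (⊤ : Submodule k V) ≤
          (⨆ p, (V.gr p).prod (W.gr p)).comap (LinearMap.inl k V W) := by
        rw [← V.isInternal.submodule_iSup_eq_top]
        exact iSup_le fun p x hx => Submodule.mem_iSup_of_mem p ⟨hx, Submodule.zero_mem _⟩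
      have h2 : (⊤ : Submodule k W) ≤
          (⨆ p, (V.gr p).prod (W.gr p)).comap (LinearMap.inr k V W) := by
        rw [← W.isInternal.submodule_iSup_eq_top]
        exact iSup_le fun p x hx => Submodule.mem_iSup_of_mem p ⟨Submodule.zero_mem _, hx⟩
      have h3 : ((x, y) : V × W) = LinearMap.inl k V W x + LinearMap.inr k V W y := by simp
      rw [h3]
      exact Submodule.add_mem _ (h1 (Submodule.mem_top : x ∈ ⊤))
        (h2 (Submodule.mem_top : y ∈ ⊤))
  d := V.d.prodMap W.d
  d_mem := fun hx => ⟨V.d_mem hx.1, W.d_mem hx.2⟩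
  d_d := fun x => Prod.ext (V.d_d x.1) (W.d_d x.2)

end DGVect

/-- A type of decorations ("colours") of flags, with the relation saying when two flags may be glued
to form an edge. -/
class FlagColour (C : Type) where
  glue : C → C → Prop
  glue_symm : ∀ {c c' : C}, glue c c' → glue c' c

/-- Undecorated flags: any two flags may be glued. -/
instance : FlagColour Unit where
  glue _ _ := True
  glue_symm h := h

/-- The direction of a flag: an input or an output. -/
inductive Dir
  | input
  | output
  deriving DecidableEq

instance : Fintype Dir where
  elems := {Dir.input, Dir.output}
  complete c := by cases c <;> simp

/-- The opposite direction. -/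
def Dir.flip : Dir → Dir
  | .input => .output
  | .output => .input

/-- Directed flags: an edge is formed by one output and one input. -/
instance : FlagColour Dir where
  glue c c' := c ≠ c'
  glue_symm h := h.symm

/-- The bijection that is `σ` on the first `n` elements and fixes the last one. -/
def extendLast {n n' : ℕ} (σ : Fin n ≃ Fin n') : Fin (n + 1) ≃ Fin (n' + 1) :=
  finSumFinEquiv.symm.trans ((σ.sumCongr (Equiv.refl (Fin 1))).trans finSumFinEquiv)

/-- The bijection that fixes the first element and is `τ` on the others. -/
def extendFirst {m m' : ℕ} (τ : Fin m ≃ Fin m') : Fin (m + 1) ≃ Fin (m' + 1) :=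
  (finSuccEquiv m).trans ((Equiv.optionCongr τ).trans (finSuccEquiv m').symm)

/-- The bijection that is `σ` on the first `n` and `τ` on the last `m` elements. -/
def blockSum {n n' m m' : ℕ} (σ : Fin n ≃ Fin n') (τ : Fin m ≃ Fin m') :
    Fin (n + m) ≃ Fin (n' + m') :=
  finSumFinEquiv.symm.trans ((σ.sumCongr τ).trans finSumFinEquiv)

/-- The last flag of a corolla coloured by `a` may be glued to the first flag of a corolla coloured
by `b`, and `c` is the colouring of the remaining flags: first those of `a`, then those of `b`. -/
structure Composable {C : Type} [FlagColour C] {n m : ℕ} (a : Fin (n + 1) → C)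
    (b : Fin (m + 1) → C) (c : Fin (n + m) → C) : Prop where
  glue : FlagColour.glue (a (Fin.last n)) (b 0)
  left : ∀ i : Fin n, c (Fin.castAdd m i) = a i.castSucc
  right : ∀ j : Fin m, c (Fin.natAdd n j) = b j.succ

/-- A (non-unital, symmetric) operad in dg vector spaces whose operations are composed along trees
with flags coloured by `C`.  It consists of a dg vector space `obj n c` for every corolla with flags
`0, …, n - 1` coloured by `c`, of the action of the colour preserving bijections of the flags, and
of the compositions along trees with one edge.  By equivariance it is enough to record the
compositions that glue the last flag of the first corolla to the first flag of the second one. -/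
structure FlagOperad (k : Type u) [Field k] (C : Type) [FlagColour C] where
  obj : (n : ℕ) → (Fin n → C) → DGVect.{u} k
  /-- the action of bijections -/
  map : {n m : ℕ} → (σ : Fin n ≃ Fin m) → {c : Fin n → C} → {c' : Fin m → C} →
    (∀ i, c' (σ i) = c i) → (obj n c →ₗ[k] obj m c')
  map_mem : ∀ {n m : ℕ} (σ : Fin n ≃ Fin m) {c : Fin n → C} {c' : Fin m → C}
    (h : ∀ i, c' (σ i) = c i) {p : ℤ} {x : obj n c}, x ∈ (obj n c).gr p →
    map σ h x ∈ (obj m c').gr p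
  map_d : ∀ {n m : ℕ} (σ : Fin n ≃ Fin m) {c : Fin n → C} {c' : Fin m → C}
    (h : ∀ i, c' (σ i) = c i) (x : obj n c), map σ h ((obj n c).d x) = (obj m c').d (map σ h x)
  map_refl : ∀ {n : ℕ} {c : Fin n → C} (h : ∀ i, c (Equiv.refl (Fin n) i) = c i) (x : obj n c),
    map (Equiv.refl (Fin n)) h x = x
  map_trans : ∀ {n m l : ℕ} (σ : Fin n ≃ Fin m) (τ : Fin m ≃ Fin l) {c : Fin n → C}
    {c' : Fin m → C} {c'' : Fin l → C} (h : ∀ i, c' (σ i) = c i) (h' : ∀ i, c'' (τ i) = c' i)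
    (h'' : ∀ i, c'' (σ.trans τ i) = c i) (x : obj n c),
    map (σ.trans τ) h'' x = map τ h' (map σ h x)
  /-- the composition that glues the last flag of the first argument to the first flag of the
  second argument -/
  comp : {n m : ℕ} → {a : Fin (n + 1) → C} → {b : Fin (m + 1) → C} → {c : Fin (n + m) → C} →
    Composable a b c → (obj (n + 1) a →ₗ[k] obj (m + 1) b →ₗ[k] obj (n + m) c)
  comp_mem : ∀ {n m : ℕ} {a : Fin (n + 1) → C} {b : Fin (m + 1) → C} {c : Fin (n + m) → C}
    (h : Composable a b c) {p q : ℤ} {x : obj (n + 1) a} {y : obj (m + 1) b},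
    x ∈ (obj (n + 1) a).gr p → y ∈ (obj (m + 1) b).gr q →
    comp h x y ∈ (obj (n + m) c).gr (p + q)
  comp_d : ∀ {n m : ℕ} {a : Fin (n + 1) → C} {b : Fin (m + 1) → C} {c : Fin (n + m) → C}
    (h : Composable a b c) {p : ℤ} {x : obj (n + 1) a} (y : obj (m + 1) b),
    x ∈ (obj (n + 1) a).gr p →
    (obj (n + m) c).d (comp h x y) =
      comp h ((obj (n + 1) a).d x) y + (-1 : k) ^ p • comp h x ((obj (m + 1) b).d y)
  /-- equivariance -/
  comp_map : ∀ {n m n' m' : ℕ} (σ : Fin n ≃ Fin n') (τ : Fin m ≃ Fin m')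
    {a : Fin (n + 1) → C} {b : Fin (m + 1) → C} {c : Fin (n + m) → C}
    {a' : Fin (n' + 1) → C} {b' : Fin (m' + 1) → C} {c' : Fin (n' + m') → C}
    (ha : ∀ i, a' (extendLast σ i) = a i) (hb : ∀ i, b' (extendFirst τ i) = b i)
    (hc : ∀ i, c' (blockSum σ τ i) = c i) (h : Composable a b c) (h' : Composable a' b' c')
    (x : obj (n + 1) a) (y : obj (m + 1) b),
    comp h' (map (extendLast σ) ha x) (map (extendFirst τ) hb y) =
      map (blockSum σ τ) hc (comp h x y)
  /-- symmetry: the two arguments may be exchanged, after moving the first flag of the second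
  argument to the last place and the last flag of the first argument to the first place -/
  comp_comm : ∀ {n m : ℕ} {a : Fin (n + 1) → C} {b : Fin (m + 1) → C} {c : Fin (n + m) → C}
    {a' : Fin (n + 1) → C} {b' : Fin (m + 1) → C} {c' : Fin (m + n) → C}
    (ha : ∀ i, a' (finRotate (n + 1) i) = a i) (hb : ∀ i, b' ((finRotate (m + 1)).symm i) = b i)
    (hc : ∀ i, c' (finAddFlip i) = c i) (h : Composable a b c) (h' : Composable b' a' c')
    {p q : ℤ} {x : obj (n + 1) a} {y : obj (m + 1) b},
    x ∈ (obj (n + 1) a).gr p → y ∈ (obj (m + 1) b).gr q →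
    comp h' (map (finRotate (m + 1)).symm hb y) (map (finRotate (n + 1)) ha x) =
      (-1 : k) ^ (p * q) • map finAddFlip hc (comp h x y)
  /-- associativity: contracting the two edges of a tree with three vertices in either order gives
  the same result (the reindexings are the order preserving ones) -/
  comp_assoc : ∀ {n m l : ℕ} {a : Fin (n + 1) → C} {b : Fin (m + 1 + 1) → C}
    {c : Fin (l + 1) → C} {ab : Fin (n + m + 1) → C} {bc : Fin (m + 1 + l) → C}
    {bc' : Fin (m + l + 1) → C} {abc : Fin (n + m + l) → C} {abc' : Fin (n + (m + l)) → C}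
    (hab : Composable (m := m + 1) a b ab) (habc : Composable ab c abc)
    (hbc : Composable (n := m + 1) b c bc)
    (hr : ∀ i, bc' (finCongr (by omega : m + 1 + l = m + l + 1) i) = bc i)
    (habc' : Composable (m := m + l) a bc' abc')
    (hs : ∀ i, abc' (finCongr (Nat.add_assoc n m l) i) = abc i)
    (x : obj (n + 1) a) (y : obj (m + 1 + 1) b) (z : obj (l + 1) c),
    map (finCongr (Nat.add_assoc n m l)) hs (comp habc (comp (m := m + 1) hab x y) z) =
      comp (m := m + l) habc' x (map (finCongr (by omega)) hr (comp (n := m + 1) hbc y z))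

namespace FlagOperad

variable {k : Type u} [Field k] {C : Type} [FlagColour C]

/-- A morphism of operads: a family of chain maps of degree `0` compatible with the actions of
bijections and with the compositions. -/
@[ext]
structure Hom (P Q : FlagOperad k C) where
  app : (n : ℕ) → (c : Fin n → C) → (P.obj n c →ₗ[k] Q.obj n c)
  app_mem : ∀ (n : ℕ) (c : Fin n → C) {p : ℤ} {x : P.obj n c}, x ∈ (P.obj n c).gr p →
    app n c x ∈ (Q.obj n c).gr p
  app_d : ∀ (n : ℕ) (c : Fin n → C) (x : P.obj n c),
    app n c ((P.obj n c).d x) = (Q.obj n c).d (app n c x)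
  app_map : ∀ {n m : ℕ} (σ : Fin n ≃ Fin m) {c : Fin n → C} {c' : Fin m → C}
    (h : ∀ i, c' (σ i) = c i) (x : P.obj n c), app m c' (P.map σ h x) = Q.map σ h (app n c x)
  app_comp : ∀ {n m : ℕ} {a : Fin (n + 1) → C} {b : Fin (m + 1) → C} {c : Fin (n + m) → C}
    (h : Composable a b c) (x : P.obj (n + 1) a) (y : P.obj (m + 1) b),
    app (n + m) c (P.comp h x y) = Q.comp h (app (n + 1) a x) (app (m + 1) b y)

instance : Category (FlagOperad k C) where
  Hom := Hom
  id P :=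
    { app := fun _ _ => LinearMap.id
      app_mem := fun _ _ _ _ h => h
      app_d := fun _ _ _ => rfl
      app_map := fun _ _ _ _ _ => rfl
      app_comp := fun _ _ _ => rfl }
  comp f g :=
    { app := fun n c => g.app n c ∘ₗ f.app n c
      app_mem := fun n c _ _ h => g.app_mem n c (f.app_mem n c h)
      app_d := fun n c x => by simp [f.app_d, g.app_d]
      app_map := fun σ _ _ h x => by simp [f.app_map, g.app_map]
      app_comp := fun h x y => by simp [f.app_comp, g.app_comp] }

end FlagOperad

/-- Cyclic operads in dg vector spaces: `O((n))` is `O.obj n c` for the unique `c : Fin n → Unit`. -/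
abbrev CyclicOperad (k : Type u) [Field k] := FlagOperad k Unit

/-- Dioperads in dg vector spaces: for `c : Fin n → Dir` with `r` outputs and `s` inputs, `P.obj n c`
is the space `P(r, s)` of operations whose outputs and inputs are labelled by the places where `c` is
`Dir.output` and `Dir.input`.  Operations without inputs or without outputs are allowed. -/
abbrev Dioperad (k : Type u) [Field k] := FlagOperad k Dir

/-- The Koszul sign of the permutation `σ` acting on vectors of degrees `p 0, …, p (n - 1)`. -/
def koszulSign {n m : ℕ} (σ : Fin n ≃ Fin m) (p : Fin n → ℤ) : ℤˣ :=
  ∏ i, ∏ j, if i < j ∧ σ j < σ i then (p i * p j).negOnePow else 1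

namespace TensorEnd

/-- A sign, as a scalar. -/
def sg (k : Type u) [Field k] (e : ℤˣ) : k := ((e : ℤ) : k)

@[simp] theorem sg_one (k : Type u) [Field k] : sg k 1 = 1 := by simp [sg]

theorem sg_mul (k : Type u) [Field k] (e f : ℤˣ) : sg k (e * f) = sg k e * sg k f := by simp [sg]

theorem sg_prod (k : Type u) [Field k] {ι : Type*} (s : Finset ι) (e : ι → ℤˣ) :
    sg k (∏ i ∈ s, e i) = ∏ i ∈ s, sg k (e i) := by simp [sg]

theorem sg_negOnePow (k : Type u) [Field k] (p : ℤ) : sg k p.negOnePow = (-1) ^ p := by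
  rcases Int.even_or_odd p with h | h
  · simp [sg, Int.negOnePow_even p h, h.neg_one_zpow]
  · simp [sg, Int.negOnePow_odd p h, h.neg_one_zpow]

variable {k : Type u} [Field k] {C : Type} (V : C → DGVect.{u} k)

/-- Transport along an equality of colours. -/
def castV {c c' : C} (h : c = c') : V c →ₗ[k] V c' := h ▸ LinearMap.id

@[simp] theorem castV_rfl {c : C} (h : c = c) (x : V c) : castV V h x = x := rfl

theorem castV_mem {c c' : C} (h : c = c') {p : ℤ} {x : V c} (hx : x ∈ (V c).gr p) :
    castV V h x ∈ (V c').gr p := by subst h; exact hx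

theorem castV_d {c c' : C} (h : c = c') (x : V c) :
    castV V h ((V c).d x) = (V c').d (castV V h x) := by subst h; rfl

@[simp] theorem castV_castV {c c' c'' : C} (h : c = c') (h' : c' = c'') (x : V c) :
    castV V h' (castV V h x) = castV V (h.trans h') x := by subst h; subst h'; rfl

theorem castV_apply {n : ℕ} {c : Fin n → C} (v : ∀ i, V (c i)) {i j : Fin n} (h : i = j)
    (h' : c i = c j) : castV V h' (v i) = v j := by subst h; rfl

/-- The tensor product of the spaces `V (c i)`. -/
abbrev T {n : ℕ} (c : Fin n → C) : Type u := ⨂[k] i, (V (c i)).carrier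

/-- A family of vectors is homogeneous of the given degrees. -/
def Homog {n : ℕ} (c : Fin n → C) (p : Fin n → ℤ) (v : ∀ i, V (c i)) : Prop :=
  ∀ i, v i ∈ (V (c i)).gr (p i)

/-- The component of degree `q`: the span of the pure tensors of homogeneous vectors of total
degree `q`. -/
def tgr {n : ℕ} (c : Fin n → C) (q : ℤ) : Submodule k (T V c) :=
  Submodule.span k {t | ∃ (p : Fin n → ℤ) (v : ∀ i, V (c i)), Homog V c p v ∧ ∑ i, p i = q ∧
    t = PiTensorProduct.tprod k v}

variable {V}

theorem tprod_mem {n : ℕ} {c : Fin n → C} {p : Fin n → ℤ} {v : ∀ i, V (c i)}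
    (h : Homog V c p v) {q : ℤ} (hq : ∑ i, p i = q) : PiTensorProduct.tprod k v ∈ tgr V c q :=
  Submodule.subset_span ⟨p, v, h, hq, rfl⟩

theorem hom_ext {n : ℕ} {c : Fin n → C} {M : Type*} [AddCommGroup M] [Module k M]
    {f g : T V c →ₗ[k] M}
    (h : ∀ p v, Homog V c p v → f (PiTensorProduct.tprod k v) = g (PiTensorProduct.tprod k v)) :
    f = g := by
  refine PiTensorProduct.ext ?_
  let b : ∀ i, Module.Basis (Σ q, Module.Basis.ofVectorSpaceIndex k ((V (c i)).gr q)) k (V (c i)) :=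
    fun i => (V (c i)).isInternal.collectedBasis
      fun q => Module.Basis.ofVectorSpace k ((V (c i)).gr q)
  refine Module.Basis.ext_multilinear b fun v => ?_
  exact h (fun i => (v i).1) _ fun i => (V (c i)).isInternal.collectedBasis_mem _ _

theorem ext_of_mem {n : ℕ} {c : Fin n → C} {M : Type*} [AddCommGroup M] [Module k M]
    {f g : T V c →ₗ[k] M} {q : ℤ}
    (h : ∀ p v, Homog V c p v → ∑ i, p i = q →
      f (PiTensorProduct.tprod k v) = g (PiTensorProduct.tprod k v))
    {x : T V c} (hx : x ∈ tgr V c q) : f x = g x := by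
  have : tgr V c q ≤ LinearMap.eqLocus f g := by
    refine Submodule.span_le.2 ?_
    rintro _ ⟨p, v, hv, hq, rfl⟩
    exact h p v hv hq
  exact this hx

theorem mem_of_mem {n : ℕ} {c : Fin n → C} {M : Type*} [AddCommGroup M] [Module k M]
    {f : T V c →ₗ[k] M} {q : ℤ} {S : Submodule k M}
    (h : ∀ p v, Homog V c p v → ∑ i, p i = q → f (PiTensorProduct.tprod k v) ∈ S)
    {x : T V c} (hx : x ∈ tgr V c q) : f x ∈ S := by
  have : tgr V c q ≤ S.comap f := by
    refine Submodule.span_le.2 ?_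
    rintro _ ⟨p, v, hv, hq, rfl⟩
    exact h p v hv hq
  exact this hx

theorem isInternal_span {M ι : Type*} [AddCommGroup M] [Module k M] (b : Module.Basis ι k M)
    (deg : ι → ℤ) : DirectSum.IsInternal fun q => Submodule.span k (b '' {i | deg i = q}) := by
  rw [DirectSum.isInternal_submodule_iff_iSupIndep_and_iSup_eq_top]
  constructor
  · intro q
    have : (⨆ j, ⨆ (_ : j ≠ q), Submodule.span k (b '' {i | deg i = j}))
        ≤ Submodule.span k (b '' {i | deg i ≠ q}) := by
      refine iSup_le fun j => iSup_le fun hj => Submodule.span_mono (Set.image_mono ?_)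
      intro i hi
      simp only [Set.mem_ofPred_eq] at hi ⊢
      rw [hi]; exact hj
    refine Disjoint.mono_right this (b.linearIndependent.disjoint_span_image ?_)
    rw [Set.disjoint_left]
    intro i hi hi'
    exact hi' hi
  · rw [eq_top_iff, ← b.span_eq]
    refine Submodule.span_le.2 ?_
    rintro _ ⟨i, rfl⟩
    exact Submodule.mem_iSup_of_mem (deg i) (Submodule.subset_span ⟨i, rfl, rfl⟩)

theorem tgr_isInternal {n : ℕ} (c : Fin n → C) : DirectSum.IsInternal (tgr V c) := by
  classical
  let b : ∀ i, Module.Basis (Σ q, Module.Basis.ofVectorSpaceIndex k ((V (c i)).gr q)) k (V (c i)) :=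
    fun i => (V (c i)).isInternal.collectedBasis
      fun q => Module.Basis.ofVectorSpace k ((V (c i)).gr q)
  have key : tgr V c = fun q => Submodule.span k
      (Basis.piTensorProduct b '' {κ | ∑ i, (κ i).1 = q}) := by
    ext1 q
    refine le_antisymm (Submodule.span_le.2 ?_) (Submodule.span_le.2 ?_)
    · rintro _ ⟨p, v, hv, hq, rfl⟩
      rw [SetLike.mem_coe, Module.Basis.mem_span_image]
      intro κ hκ
      simp only [Finset.mem_coe, Finsupp.mem_support_iff] at hκ
      rw [Basis.piTensorProduct_repr_tprod_apply] at hκ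
      rw [Set.mem_ofPred_eq, ← hq]
      refine Finset.sum_congr rfl fun i _ => ?_
      by_contra hne
      refine hκ (Finset.prod_eq_zero (Finset.mem_univ i) ?_)
      exact (V (c i)).isInternal.collectedBasis_repr_of_mem_ne _ (Ne.symm hne) (hv i)
    · rintro _ ⟨κ, hκ, rfl⟩
      rw [Basis.piTensorProduct_apply]
      exact tprod_mem (p := fun i => (κ i).1)
        (fun i => (V (c i)).isInternal.collectedBasis_mem _ _) hκ
  rw [key]
  exact isInternal_span (Basis.piTensorProduct b) fun κ => ∑ i, (κ i).1

/-! ### The differential -/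

variable (V) in
/-- The differential, by the Leibniz rule with Koszul signs. -/
noncomputable def td {n : ℕ} (c : Fin n → C) : T V c →ₗ[k] T V c :=
  ∑ i, PiTensorProduct.map fun j =>
    if j < i then (V (c j)).eps else if j = i then (V (c j)).d else LinearMap.id

theorem prod_negOnePow {ι : Type*} (s : Finset ι) (f : ι → ℤ) :
    ∏ i ∈ s, (f i).negOnePow = (∑ i ∈ s, f i).negOnePow := by
  classical
  induction s using Finset.induction_on with
  | empty => simp
  | insert a s ha ih => rw [Finset.prod_insert ha, Finset.sum_insert ha, Int.negOnePow_add, ih]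

theorem tprod_homog_map {n : ℕ} {c : Fin n → C} {p : Fin n → ℤ} {v : ∀ i, V (c i)}
    (h : Homog V c p v) (i : Fin n) :
    PiTensorProduct.map (R := k) (fun j =>
      if j < i then (V (c j)).eps else if j = i then (V (c j)).d else LinearMap.id)
      (PiTensorProduct.tprod k v) =
    sg k (∑ j, if j < i then p j else 0).negOnePow •
      PiTensorProduct.tprod k (Function.update v i ((V (c i)).d (v i))) := by
  rw [PiTensorProduct.map_tprod, ← prod_negOnePow, sg_prod, ← MultilinearMap.map_smul_univ]
  congr 1
  ext j
  rcases lt_trichotomy j i with hj | hj | hj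
  · simp [hj, hj.ne, (V (c j)).eps_of_mem (h j), sg_negOnePow]
  · subst hj; simp
  · simp [hj.not_gt, hj.ne']

theorem td_tprod {n : ℕ} {c : Fin n → C} {p : Fin n → ℤ} {v : ∀ i, V (c i)}
    (h : Homog V c p v) :
    td V c (PiTensorProduct.tprod k v) = ∑ i, sg k (∑ j, if j < i then p j else 0).negOnePow •
      PiTensorProduct.tprod k (Function.update v i ((V (c i)).d (v i))) := by
  rw [td, LinearMap.sum_apply]
  exact Finset.sum_congr rfl fun i _ => tprod_homog_map h i

theorem Homog.update_d {n : ℕ} {c : Fin n → C} {p : Fin n → ℤ} {v : ∀ i, V (c i)}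
    (h : Homog V c p v) (i : Fin n) :
    Homog V c (Function.update p i (p i + 1)) (Function.update v i ((V (c i)).d (v i))) := by
  intro j
  by_cases hj : j = i
  · subst hj; simpa using (V (c j)).d_mem (h j)
  · simpa only [Function.update_of_ne hj] using h j

theorem sum_update {n : ℕ} (p : Fin n → ℤ) (i : Fin n) :
    ∑ j, Function.update p i (p i + 1) j = ∑ j, p j + 1 := by
  rw [Finset.sum_update_of_mem (Finset.mem_univ i), ← Finset.add_sum_erase _ p (Finset.mem_univ i),
    Finset.sdiff_singleton_eq_erase]
  ring

theorem tprod_update_neg {n : ℕ} {c : Fin n → C} (v : ∀ i, V (c i)) (i : Fin n) (x : V (c i)) :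
    PiTensorProduct.tprod k (Function.update v i (-x)) =
      - PiTensorProduct.tprod k (Function.update v i x) := by
  have := (PiTensorProduct.tprod k).map_update_smul v i (-1 : k) x
  simpa only [neg_smul, one_smul] using this

theorem td_td {n : ℕ} (c : Fin n → C) (x : T V c) : td V c (td V c x) = 0 := by
  let D : Fin n → T V c →ₗ[k] T V c := fun i => PiTensorProduct.map fun j =>
    if j < i then (V (c j)).eps else if j = i then (V (c j)).d else LinearMap.id
  have hD : ∀ i j, i < j → ∀ x, D i (D j x) + D j (D i x) = 0 := by
    intro i j hij
    have : D i ∘ₗ D j + D j ∘ₗ D i = 0 := by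
      refine PiTensorProduct.ext ?_
      ext v
      simp only [LinearMap.compMultilinearMap_apply, LinearMap.add_apply, LinearMap.comp_apply,
        LinearMap.zero_apply, D, PiTensorProduct.map_tprod]
      rw [add_eq_zero_iff_eq_neg]
      rw [show (fun l => (if l < j then (V (c l)).eps else if l = j then (V (c l)).d
          else LinearMap.id) ((if l < i then (V (c l)).eps else if l = i then (V (c l)).d
          else LinearMap.id) (v l))) = Function.update (fun l => (if l < i then (V (c l)).eps
          else if l = i then (V (c l)).d else LinearMap.id) ((if l < j then (V (c l)).eps
          else if l = j then (V (c l)).d else LinearMap.id) (v l))) i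
          (- (V (c i)).d ((V (c i)).eps (v i))) from ?_]
      · rw [tprod_update_neg, neg_neg]
        congr 1
        ext l
        by_cases hl : l = i
        · subst hl; simp [hij]
        · simp [hl]
      · ext l
        rcases lt_trichotomy l i with hl | hl | hl
        · simp [hl, hl.ne, hl.trans hij]
        · subst hl; simp [hij, (V (c l)).d_eps]
        · rcases lt_trichotomy l j with hl' | hl' | hl'
          · simp [hl.ne', hl.not_gt, hl']
          · subst hl'; simp [hl.ne', hl.not_gt]
          · simp [hl.ne', hl.not_gt, hl'.ne', hl'.not_gt]
    exact fun x => LinearMap.congr_fun this x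
  have hDD : ∀ i x, D i (D i x) = 0 := by
    intro i
    have : D i ∘ₗ D i = 0 := by
      refine PiTensorProduct.ext ?_
      ext v
      simp only [LinearMap.compMultilinearMap_apply, LinearMap.comp_apply,
        LinearMap.zero_apply, D, PiTensorProduct.map_tprod]
      refine MultilinearMap.map_coord_zero _ i ?_
      simp [(V (c i)).d_d]
    exact fun x => LinearMap.congr_fun this x
  have hsum : td V c (td V c x) = ∑ z : Fin n × Fin n, D z.1 (D z.2 x) := by
    simp only [td, LinearMap.sum_apply, map_sum, Fintype.sum_prod_type]
    exact Finset.sum_comm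
  rw [hsum]
  refine Finset.sum_involution (fun z _ => (z.2, z.1)) ?_ ?_ ?_ ?_
  · rintro ⟨i, j⟩ -
    rcases lt_trichotomy i j with h | h | h
    · exact hD i j h x
    · subst h; simp [hDD]
    · rw [add_comm]; exact hD j i h x
  · rintro ⟨i, j⟩ - hne heq
    simp only [Prod.mk.injEq] at heq
    obtain ⟨h1, h2⟩ := heq
    subst h1
    exact hne (hDD _ x)
  · intro z _; exact Finset.mem_univ _
  · intro z _; rfl

variable (V) in
/-- The dg vector space `⨂ i, V (c i)`. -/
noncomputable def tensor {n : ℕ} (c : Fin n → C) : DGVect k where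
  carrier := T V c
  gr := tgr V c
  isInternal := tgr_isInternal c
  d := td V c
  d_mem := fun {q x} hx => by
    refine mem_of_mem (f := td V c) (S := tgr V c (q + 1)) (fun p v hv hq => ?_) hx
    rw [td_tprod hv]
    refine Submodule.sum_mem _ fun i _ => ?_
    refine Submodule.smul_mem _ _ (tprod_mem (hv.update_d i) ?_)
    rw [sum_update, hq]
  d_d := td_td c

end TensorEnd

/-! ### Koszul signs -/

theorem extendLast_castSucc {n n' : ℕ} (σ : Fin n ≃ Fin n') (i : Fin n) :
    extendLast σ i.castSucc = (σ i).castSucc := by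
  change extendLast σ (Fin.castAdd 1 i) = Fin.castAdd 1 (σ i)
  simp only [extendLast, Equiv.trans_apply, finSumFinEquiv_symm_apply_castAdd]
  simp

theorem extendLast_last {n n' : ℕ} (σ : Fin n ≃ Fin n') :
    extendLast σ (Fin.last n) = Fin.last n' := by
  change extendLast σ (Fin.natAdd n (0 : Fin 1)) = Fin.natAdd n' (0 : Fin 1)
  simp only [extendLast, Equiv.trans_apply, finSumFinEquiv_symm_apply_natAdd]
  simp

theorem extendFirst_zero {m m' : ℕ} (τ : Fin m ≃ Fin m') : extendFirst τ 0 = 0 := by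
  simp [extendFirst]

theorem extendFirst_succ {m m' : ℕ} (τ : Fin m ≃ Fin m') (i : Fin m) :
    extendFirst τ i.succ = (τ i).succ := by
  simp [extendFirst]

theorem blockSum_castAdd {n n' m m' : ℕ} (σ : Fin n ≃ Fin n') (τ : Fin m ≃ Fin m') (i : Fin n) :
    blockSum σ τ (Fin.castAdd m i) = Fin.castAdd m' (σ i) := by
  simp [blockSum]

theorem blockSum_natAdd {n n' m m' : ℕ} (σ : Fin n ≃ Fin n') (τ : Fin m ≃ Fin m') (i : Fin m) :
    blockSum σ τ (Fin.natAdd n i) = Fin.natAdd n' (τ i) := by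
  simp [blockSum]

theorem finRotate_castSucc {n : ℕ} (i : Fin n) : finRotate (n + 1) i.castSucc = i.succ := by
  rw [finRotate_apply]; exact Fin.coeSucc_eq_succ

theorem finRotate_symm_zero {n : ℕ} : (finRotate (n + 1)).symm 0 = Fin.last n := by
  rw [Equiv.symm_apply_eq, finRotate_last]

theorem finRotate_symm_succ {n : ℕ} (i : Fin n) :
    (finRotate (n + 1)).symm i.succ = i.castSucc := by
  rw [Equiv.symm_apply_eq, finRotate_castSucc]

theorem koszulSign_of_strictMono {n m : ℕ} (σ : Fin n ≃ Fin m) (h : ∀ i j, i < j → σ i < σ j)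
    (p : Fin n → ℤ) : koszulSign σ p = 1 := by
  refine Finset.prod_eq_one fun i _ => Finset.prod_eq_one fun j _ => ?_
  rw [if_neg]
  rintro ⟨h1, h2⟩
  exact absurd (h i j h1) h2.not_gt

theorem negOnePow_congr {a b : ℤ} (h : a % 2 = b % 2) : a.negOnePow = b.negOnePow := by
  rw [Int.negOnePow_eq_iff, Int.even_iff]; omega

theorem koszulSign_congr {n m : ℕ} (σ : Fin n ≃ Fin m) {p q : Fin n → ℤ}
    (h : ∀ i, p i % 2 = q i % 2) : koszulSign σ p = koszulSign σ q := by
  refine Finset.prod_congr rfl fun i _ => Finset.prod_congr rfl fun j _ => ?_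
  split_ifs
  · apply negOnePow_congr
    rw [Int.mul_emod, h i, h j, ← Int.mul_emod]
  · rfl

theorem koszulSign_eq_pairs {n m : ℕ} (σ : Fin n ≃ Fin m) (p : Fin n → ℤ) :
    koszulSign σ p = ∏ z : Fin n × Fin n with z.1 < z.2,
      if σ z.2 < σ z.1 then (p z.1 * p z.2).negOnePow else 1 := by
  rw [koszulSign, ← Fintype.prod_prod_type', Finset.prod_filter]
  refine Finset.prod_congr rfl fun z _ => ?_
  by_cases h : z.1 < z.2 <;> simp [h]

theorem negOnePow_mul_self' (a : ℤ) : a.negOnePow * a.negOnePow = 1 := by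
  rw [← Int.negOnePow_add, ← two_mul, Int.negOnePow_two_mul]

theorem koszulSign_trans {n m l : ℕ} (σ : Fin n ≃ Fin m) (τ : Fin m ≃ Fin l) (p : Fin n → ℤ) :
    koszulSign (σ.trans τ) p = koszulSign τ (fun j => p (σ.symm j)) * koszulSign σ p := by
  have key : koszulSign τ (fun j => p (σ.symm j)) = ∏ z : Fin n × Fin n with z.1 < z.2,
      if (σ z.1 < σ z.2 ∧ τ (σ z.2) < τ (σ z.1)) ∨ (σ z.2 < σ z.1 ∧ τ (σ z.1) < τ (σ z.2))
      then (p z.1 * p z.2).negOnePow else 1 := by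
    rw [koszulSign_eq_pairs]
    symm
    refine Finset.prod_bij' (fun z _ => if σ z.1 < σ z.2 then (σ z.1, σ z.2) else (σ z.2, σ z.1))
      (fun z _ => if σ.symm z.1 < σ.symm z.2 then (σ.symm z.1, σ.symm z.2)
        else (σ.symm z.2, σ.symm z.1)) ?_ ?_ ?_ ?_ ?_
    · rintro ⟨i, j⟩ h
      simp only [Finset.mem_filter, Finset.mem_univ, true_and] at h ⊢
      split_ifs with h1
      · exact h1
      · exact lt_of_le_of_ne (not_lt.1 h1) (fun h2 => h.ne' (σ.injective h2))
    · rintro ⟨i, j⟩ h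
      simp only [Finset.mem_filter, Finset.mem_univ, true_and] at h ⊢
      split_ifs with h1
      · exact h1
      · exact lt_of_le_of_ne (not_lt.1 h1) (fun h2 => h.ne' (σ.symm.injective h2))
    · rintro ⟨i, j⟩ h
      simp only [Finset.mem_filter, Finset.mem_univ, true_and] at h
      by_cases h1 : σ i < σ j
      · simp [h1, h]
      · simp [h1, h.not_gt]
    · rintro ⟨i, j⟩ h
      simp only [Finset.mem_filter, Finset.mem_univ, true_and] at h
      by_cases h1 : σ.symm i < σ.symm j
      · simp [h1, h]
      · simp [h1, h.not_gt]
    · rintro ⟨i, j⟩ h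
      simp only [Finset.mem_filter, Finset.mem_univ, true_and] at h
      by_cases h1 : σ i < σ j
      · simp [h1, h1.not_gt]
      · have h2 : σ j < σ i :=
          lt_of_le_of_ne (not_lt.1 h1) (fun h2 => h.ne' (σ.injective h2))
        simp [h1, h2, mul_comm (p j)]
  rw [key, koszulSign_eq_pairs, koszulSign_eq_pairs, ← Finset.prod_mul_distrib]
  refine Finset.prod_congr rfl ?_
  rintro ⟨i, j⟩ h
  simp only [Finset.mem_filter, Finset.mem_univ, true_and] at h
  simp only [Equiv.trans_apply]
  rcases lt_trichotomy (σ i) (σ j) with h1 | h1 | h1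
  · by_cases h2 : τ (σ j) < τ (σ i) <;> simp [h1, h1.not_gt, h2]
  · exact absurd (σ.injective h1) h.ne
  · rcases lt_trichotomy (τ (σ i)) (τ (σ j)) with h2 | h2 | h2
    · simp [h1, h1.not_gt, h2, h2.not_gt]
    · exact absurd (σ.injective (τ.injective h2)) h.ne
    · simp [h1, h1.not_gt, h2, h2.not_gt]

theorem koszulSign_update {n m : ℕ} (σ : Fin n ≃ Fin m) (p : Fin n → ℤ) (i : Fin n) :
    koszulSign σ (Function.update p i (p i + 1)) = koszulSign σ p *
      ∏ j, if (i < j ∧ σ j < σ i) ∨ (j < i ∧ σ i < σ j) then (p j).negOnePow else 1 := by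
  have key : ∀ a b, (if a < b ∧ σ b < σ a then
      (Function.update p i (p i + 1) a * Function.update p i (p i + 1) b).negOnePow else 1) =
      (if a < b ∧ σ b < σ a then (p a * p b).negOnePow else 1) *
      ((if a = i then (if i < b ∧ σ b < σ i then (p b).negOnePow else 1) else 1) *
       (if b = i then (if a < i ∧ σ i < σ a then (p a).negOnePow else 1) else 1)) := by
    intro a b
    by_cases h : a < b ∧ σ b < σ a
    · rw [if_pos h, if_pos h]
      by_cases ha : a = i
      · subst ha
        have hb : b ≠ a := h.1.ne'
        simp [hb, h, add_mul, Int.negOnePow_add]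
      · by_cases hb : b = i
        · subst hb
          simp [ha, h, mul_add, Int.negOnePow_add]
        · simp [ha, hb]
    · rw [if_neg h, if_neg h]
      by_cases ha : a = i
      · subst ha
        by_cases hb : b = a
        · subst hb; simp
        · simp [hb, h]
      · by_cases hb : b = i
        · subst hb
          simp [ha, h]
        · simp [ha, hb]
  simp only [koszulSign, key, Finset.prod_mul_distrib]
  congr 1
  have h1 : (∏ a, ∏ b, if a = i then (if i < b ∧ σ b < σ i then (p b).negOnePow else 1) else 1) =
      ∏ b, if i < b ∧ σ b < σ i then (p b).negOnePow else 1 := by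
    rw [Finset.prod_eq_single i]
    · simp
    · intro a _ ha; simp [ha]
    · simp
  rw [h1]
  simp only [Finset.prod_ite_eq', Finset.mem_univ, if_true]
  rw [← Finset.prod_mul_distrib]
  refine Finset.prod_congr rfl fun j _ => ?_
  rcases lt_trichotomy i j with h | h | h
  · simp [h, h.not_gt]
  · subst h; simp
  · simp [h, h.not_gt]

theorem koszulSign_d {n m : ℕ} (σ : Fin n ≃ Fin m) (p : Fin n → ℤ) (i : Fin n) :
    (∑ j, if j < i then p j else 0).negOnePow *
      koszulSign σ (Function.update p i (p i + 1)) =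
    koszulSign σ p * (∑ l, if l < σ i then p (σ.symm l) else 0).negOnePow := by
  rw [koszulSign_update, mul_left_comm]
  congr 1
  have h1 : (∑ l, if l < σ i then p (σ.symm l) else 0) = ∑ j, if σ j < σ i then p j else 0 := by
    rw [← Equiv.sum_comp σ]; simp
  rw [h1, ← TensorEnd.prod_negOnePow, ← TensorEnd.prod_negOnePow, ← Finset.prod_mul_distrib]
  refine Finset.prod_congr rfl fun j _ => ?_
  rcases lt_trichotomy i j with h | h | h
  · rcases lt_trichotomy (σ i) (σ j) with h' | h' | h'
    · simp [h, h.not_gt, h'.not_gt]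
    · exact absurd (σ.injective h') h.ne
    · simp [h, h.not_gt, h']
  · subst h; simp
  · rcases lt_trichotomy (σ i) (σ j) with h' | h' | h'
    · simp [h, h.not_gt, h', h'.not_gt]
    · exact absurd (σ.injective h') h.ne'
    · simp [h, h.not_gt, h', h'.not_gt]

theorem koszulSign_extendLast {n n' : ℕ} (σ : Fin n ≃ Fin n') (p : Fin (n + 1) → ℤ) :
    koszulSign (extendLast σ) p = koszulSign σ fun i => p i.castSucc := by
  simp only [koszulSign, Fin.prod_univ_castSucc, extendLast_castSucc, extendLast_last,
    Fin.castSucc_lt_castSucc_iff]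
  have h1 : ∀ i : Fin n', ¬ (Fin.last n' < i.castSucc) := fun i => (Fin.castSucc_lt_last i).not_gt
  have h2 : ∀ i : Fin n, ¬ (Fin.last n < i.castSucc) := fun i => (Fin.castSucc_lt_last i).not_gt
  simp [h1, h2]

theorem koszulSign_extendFirst {n n' : ℕ} (σ : Fin n ≃ Fin n') (p : Fin (n + 1) → ℤ) :
    koszulSign (extendFirst σ) p = koszulSign σ fun i => p i.succ := by
  simp only [koszulSign, Fin.prod_univ_succ, extendFirst_succ, extendFirst_zero,
    Fin.succ_lt_succ_iff]
  simp

theorem castAdd_lt_natAdd {n m : ℕ} (i : Fin n) (j : Fin m) : Fin.castAdd m i < Fin.natAdd n j := by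
  rw [Fin.lt_def]; simp; omega

theorem castAdd_lt_castAdd {n m : ℕ} (i j : Fin n) :
    Fin.castAdd m i < Fin.castAdd m j ↔ i < j := Iff.rfl

theorem koszulSign_blockSum {n n' m m' : ℕ} (σ : Fin n ≃ Fin n') (τ : Fin m ≃ Fin m')
    (p : Fin (n + m) → ℤ) :
    koszulSign (blockSum σ τ) p = koszulSign σ (fun i => p (Fin.castAdd m i)) *
      koszulSign τ fun j => p (Fin.natAdd n j) := by
  have h1 : ∀ (i : Fin n) (j : Fin m), ¬ Fin.natAdd n j < Fin.castAdd m i :=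
    fun i j => (castAdd_lt_natAdd i j).not_gt
  have h2 : ∀ (i : Fin n') (j : Fin m'), ¬ Fin.natAdd n' j < Fin.castAdd m' i :=
    fun i j => (castAdd_lt_natAdd i j).not_gt
  simp only [koszulSign, Fin.prod_univ_add, blockSum_castAdd, blockSum_natAdd, h1, h2,
    Fin.natAdd_lt_natAdd_iff, castAdd_lt_castAdd]
  simp

theorem koszulSign_rotate {n : ℕ} (p : Fin (n + 1) → ℤ) :
    koszulSign (finRotate (n + 1)) p =
      (p (Fin.last n) * ∑ i : Fin n, p i.castSucc).negOnePow := by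
  have h2 : ∀ i : Fin n, ¬ (Fin.last n < i.castSucc) := fun i => (Fin.castSucc_lt_last i).not_gt
  have h3 : ∀ i j : Fin n, ¬ (i < j ∧ j < i) := fun i j h => h.1.not_gt h.2
  simp only [koszulSign, Fin.prod_univ_castSucc, finRotate_castSucc, finRotate_last,
    Fin.castSucc_lt_castSucc_iff, Fin.succ_lt_succ_iff]
  simp [h2, h3, Finset.mul_sum, ← TensorEnd.prod_negOnePow, mul_comm]

theorem koszulSign_rotate_symm {n : ℕ} (p : Fin (n + 1) → ℤ) :
    koszulSign (finRotate (n + 1)).symm p = (p 0 * ∑ i : Fin n, p i.succ).negOnePow := by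
  have h2 : ∀ i : Fin n, ¬ (Fin.last n < i.castSucc) := fun i => (Fin.castSucc_lt_last i).not_gt
  have h3 : ∀ i j : Fin n, ¬ (i < j ∧ j < i) := fun i j h => h.1.not_gt h.2
  simp only [koszulSign, Fin.prod_univ_succ, finRotate_symm_zero, finRotate_symm_succ,
    Fin.castSucc_lt_castSucc_iff, Fin.succ_lt_succ_iff]
  simp [h2, h3, Finset.mul_sum, ← TensorEnd.prod_negOnePow]

theorem koszulSign_flip {n m : ℕ} (p : Fin (n + m) → ℤ) :
    koszulSign (finAddFlip : Fin (n + m) ≃ Fin (m + n)) p =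
      ((∑ i : Fin n, p (Fin.castAdd m i)) * ∑ j : Fin m, p (Fin.natAdd n j)).negOnePow := by
  have h1 : ∀ (i : Fin n) (j : Fin m), ¬ Fin.natAdd n j < Fin.castAdd m i :=
    fun i j => (castAdd_lt_natAdd i j).not_gt
  have h2 : ∀ (i : Fin n) (j : Fin m), Fin.castAdd m i < Fin.natAdd n j :=
    fun i j => castAdd_lt_natAdd i j
  have h1' : ∀ (i : Fin n) (j : Fin m), ¬ Fin.natAdd m i < Fin.castAdd n j :=
    fun i j => (castAdd_lt_natAdd j i).not_gt
  have h2' : ∀ (i : Fin n) (j : Fin m), Fin.castAdd n j < Fin.natAdd m i :=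
    fun i j => castAdd_lt_natAdd j i
  have h3 : ∀ i j : Fin n, ¬ (i < j ∧ j < i) := fun i j h => h.1.not_gt h.2
  have h4 : ∀ i j : Fin m, ¬ (i < j ∧ j < i) := fun i j h => h.1.not_gt h.2
  simp only [koszulSign, Fin.prod_univ_add, finAddFlip_apply_castAdd, finAddFlip_apply_natAdd,
    h1, h2, h2', Fin.natAdd_lt_natAdd_iff, castAdd_lt_castAdd, h3, h4]
  simp [Finset.sum_mul_sum, ← TensorEnd.prod_negOnePow]

namespace TensorEnd

variable {k : Type u} [Field k] {C : Type} {V : C → DGVect.{u} k}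

/-! ### The action of bijections -/

variable (V) in
/-- The permutation of tensor factors, without signs. -/
noncomputable def permT {n m : ℕ} (σ : Fin n ≃ Fin m) {c : Fin n → C} {c' : Fin m → C}
    (h : ∀ i, c' (σ i) = c i) : T V c →ₗ[k] T V c' :=
  (PiTensorProduct.map fun j =>
    castV V (show c (σ.symm j) = c' j by rw [← h, Equiv.apply_symm_apply])) ∘ₗ
    (PiTensorProduct.reindex k (fun i => (V (c i)).carrier) σ).toLinearMap

/-- The family of vectors obtained by permuting the family `v`. -/
def permV {n m : ℕ} (σ : Fin n ≃ Fin m) {c : Fin n → C} {c' : Fin m → C}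
    (h : ∀ i, c' (σ i) = c i) (v : ∀ i, V (c i)) : ∀ j, V (c' j) := fun j =>
  castV V (show c (σ.symm j) = c' j by rw [← h, Equiv.apply_symm_apply]) (v (σ.symm j))

theorem permT_tprod {n m : ℕ} (σ : Fin n ≃ Fin m) {c : Fin n → C} {c' : Fin m → C}
    (h : ∀ i, c' (σ i) = c i) (v : ∀ i, V (c i)) :
    permT V σ h (PiTensorProduct.tprod k v) = PiTensorProduct.tprod k (permV σ h v) := by
  rw [permT, LinearMap.comp_apply, LinearEquiv.coe_coe, PiTensorProduct.reindex_tprod,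
    PiTensorProduct.map_tprod]
  rfl

theorem permV_apply {n m : ℕ} (σ : Fin n ≃ Fin m) {c : Fin n → C} {c' : Fin m → C}
    (h : ∀ i, c' (σ i) = c i) (v : ∀ i, V (c i)) (i : Fin n) :
    permV σ h v (σ i) = castV V (h i).symm (v i) := by
  obtain rfl : c = fun i => c' (σ i) := funext fun i => (h i).symm
  exact castV_apply V (c := fun i => c' (σ i)) v (Equiv.symm_apply_apply σ i) _

theorem Homog.perm {n m : ℕ} (σ : Fin n ≃ Fin m) {c : Fin n → C} {c' : Fin m → C}
    (h : ∀ i, c' (σ i) = c i) {p : Fin n → ℤ} {v : ∀ i, V (c i)} (hv : Homog V c p v) :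
    Homog V c' (fun j => p (σ.symm j)) (permV σ h v) :=
  fun _ => castV_mem V _ (hv _)

theorem family_ext {n m : ℕ} (σ : Fin n ≃ Fin m) {c' : Fin m → C} {v w : ∀ j, V (c' j)}
    (h : ∀ i, v (σ i) = w (σ i)) : v = w := by
  ext j
  obtain ⟨i, rfl⟩ := σ.surjective j
  exact h i

/-- The projection onto the part of the given parity. -/
noncomputable def parityProj (W : DGVect k) (b : Fin 2) : W →ₗ[k] W :=
  W.scale fun p => if p % 2 = (b : ℤ) then 1 else 0

variable (V) in
/-- The action of a bijection on tensors: permutation of the factors with Koszul signs. -/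
noncomputable def act {n m : ℕ} (σ : Fin n ≃ Fin m) {c : Fin n → C} {c' : Fin m → C}
    (h : ∀ i, c' (σ i) = c i) : T V c →ₗ[k] T V c' :=
  ∑ δ : Fin n → Fin 2, sg k (koszulSign σ fun i => ((δ i : ℕ) : ℤ)) •
    (permT V σ h ∘ₗ PiTensorProduct.map fun i => parityProj (V (c i)) (δ i))

theorem act_tprod {n m : ℕ} (σ : Fin n ≃ Fin m) {c : Fin n → C} {c' : Fin m → C}
    (h : ∀ i, c' (σ i) = c i) {p : Fin n → ℤ} {v : ∀ i, V (c i)} (hv : Homog V c p v) :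
    act V σ h (PiTensorProduct.tprod k v) =
      sg k (koszulSign σ p) • PiTensorProduct.tprod k (permV σ h v) := by
  have hb : ∀ i, (p i % 2).toNat < 2 := fun i => by omega
  rw [act, LinearMap.sum_apply, Finset.sum_eq_single fun i => (⟨(p i % 2).toNat, hb i⟩ : Fin 2)]
  · rw [LinearMap.smul_apply, LinearMap.comp_apply, PiTensorProduct.map_tprod,
      koszulSign_congr σ (q := p), ← permT_tprod]
    · congr 3
      ext i
      rw [parityProj, DGVect.scale_of_mem _ _ (hv i), if_pos, one_smul]
      simp only
      omega
    · intro i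
      simp only
      omega
  · intro δ _ hδ
    obtain ⟨i, hi⟩ := Function.ne_iff.1 hδ
    rw [LinearMap.smul_apply, LinearMap.comp_apply, PiTensorProduct.map_tprod,
      MultilinearMap.map_coord_zero _ i, map_zero, smul_zero]
    rw [parityProj, DGVect.scale_of_mem _ _ (hv i), if_neg, zero_smul]
    intro h'
    apply hi
    ext
    simp only
    omega
  · intro h'; exact absurd (Finset.mem_univ _) h'

theorem act_mem {n m : ℕ} (σ : Fin n ≃ Fin m) {c : Fin n → C} {c' : Fin m → C}
    (h : ∀ i, c' (σ i) = c i) {q : ℤ} {x : T V c} (hx : x ∈ tgr V c q) :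
    act V σ h x ∈ tgr V c' q := by
  refine mem_of_mem (f := act V σ h) (fun p v hv hq => ?_) hx
  rw [act_tprod σ h hv]
  refine Submodule.smul_mem _ _ (tprod_mem (hv.perm σ h) ?_)
  rw [← hq]
  exact Equiv.sum_comp σ.symm p

theorem act_refl {n : ℕ} {c : Fin n → C} (h : ∀ i, c (Equiv.refl (Fin n) i) = c i) (x : T V c) :
    act V (Equiv.refl (Fin n)) h x = x := by
  have : act V (Equiv.refl (Fin n)) h = LinearMap.id := by
    refine hom_ext fun p v hv => ?_
    rw [act_tprod _ h hv, koszulSign_of_strictMono _ (fun _ _ h => h), sg_one, one_smul]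
    rfl
  rw [this]; rfl

theorem act_trans {n m l : ℕ} (σ : Fin n ≃ Fin m) (τ : Fin m ≃ Fin l) {c : Fin n → C}
    {c' : Fin m → C} {c'' : Fin l → C} (h : ∀ i, c' (σ i) = c i) (h' : ∀ i, c'' (τ i) = c' i)
    (h'' : ∀ i, c'' (σ.trans τ i) = c i) (x : T V c) :
    act V (σ.trans τ) h'' x = act V τ h' (act V σ h x) := by
  have : act V (σ.trans τ) h'' = act V τ h' ∘ₗ act V σ h := by
    refine hom_ext fun p v hv => ?_
    rw [LinearMap.comp_apply, act_tprod _ h'' hv, act_tprod _ h hv,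
      map_smul, act_tprod _ h' (hv.perm σ h), koszulSign_trans, smul_smul, sg_mul, mul_comm]
    congr 2
    refine family_ext (σ.trans τ) fun i => ?_
    rw [permV_apply]
    refine Eq.trans ?_ (permV_apply τ h' (permV σ h v) (σ i)).symm
    rw [permV_apply, castV_castV]
    rfl
  rw [this]; rfl

theorem permV_update {n m : ℕ} (σ : Fin n ≃ Fin m) {c : Fin n → C} {c' : Fin m → C}
    (h : ∀ i, c' (σ i) = c i) (v : ∀ i, V (c i)) (i : Fin n) (x : V (c i)) :
    permV σ h (Function.update v i x) =
      Function.update (permV σ h v) (σ i) (castV V (h i).symm x) := by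
  refine family_ext σ fun j => ?_
  rw [permV_apply]
  by_cases hj : j = i
  · subst hj; simp
  · rw [Function.update_of_ne hj, Function.update_of_ne (fun e => hj (σ.injective e)), permV_apply]

theorem act_td {n m : ℕ} (σ : Fin n ≃ Fin m) {c : Fin n → C} {c' : Fin m → C}
    (h : ∀ i, c' (σ i) = c i) (x : T V c) : act V σ h (td V c x) = td V c' (act V σ h x) := by
  have : act V σ h ∘ₗ td V c = td V c' ∘ₗ act V σ h := by
    refine hom_ext fun p v hv => ?_
    rw [LinearMap.comp_apply, LinearMap.comp_apply, td_tprod hv, act_tprod σ h hv, map_sum,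
      map_smul, td_tprod (hv.perm σ h),
      Finset.smul_sum, ← Equiv.sum_comp σ]
    refine Finset.sum_congr rfl fun i _ => ?_
    rw [map_smul, act_tprod σ h (hv.update_d i), smul_smul, smul_smul, ← sg_mul, ← sg_mul,
      koszulSign_d, permV_update, castV_d, permV_apply]
  exact LinearMap.congr_fun this x

/-! ### Contraction -/

section comp

variable {n m : ℕ} {a : Fin (n + 1) → C} {b : Fin (m + 1) → C} {c : Fin (n + m) → C}

/-- All vectors of the family `v` but the last, followed by all vectors of `w` but the first. -/
def join (hl : ∀ i : Fin n, c (Fin.castAdd m i) = a i.castSucc)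
    (hr : ∀ j : Fin m, c (Fin.natAdd n j) = b j.succ) (v : ∀ i, V (a i)) (w : ∀ j, V (b j)) :
    ∀ i, V (c i) :=
  Fin.addCases (fun i => castV V (hl i).symm (v i.castSucc))
    (fun j => castV V (hr j).symm (w j.succ))

variable (hl : ∀ i : Fin n, c (Fin.castAdd m i) = a i.castSucc)
  (hr : ∀ j : Fin m, c (Fin.natAdd n j) = b j.succ)

theorem join_left (v : ∀ i, V (a i)) (w : ∀ j, V (b j)) (i : Fin n) :
    join hl hr v w (Fin.castAdd m i) = castV V (hl i).symm (v i.castSucc) := by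
  rw [join, Fin.addCases_left]

theorem join_right (v : ∀ i, V (a i)) (w : ∀ j, V (b j)) (j : Fin m) :
    join hl hr v w (Fin.natAdd n j) = castV V (hr j).symm (w j.succ) := by
  rw [join, Fin.addCases_right]

theorem sum_family_ext {v w : ∀ i, V (c i)}
    (h1 : ∀ i : Fin n, v (Fin.castAdd m i) = w (Fin.castAdd m i))
    (h2 : ∀ j : Fin m, v (Fin.natAdd n j) = w (Fin.natAdd n j)) : v = w := by
  ext i
  induction i using Fin.addCases with
  | left i => exact h1 i
  | right j => exact h2 j

theorem join_update_last (v : ∀ i, V (a i)) (w : ∀ j, V (b j)) (x : V (a (Fin.last n))) :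
    join hl hr (Function.update v (Fin.last n) x) w = join hl hr v w := by
  refine sum_family_ext (fun i => ?_) fun j => ?_
  · rw [join_left, join_left, Function.update_of_ne (Fin.castSucc_lt_last i).ne]
  · rw [join_right, join_right]

theorem join_update_zero (v : ∀ i, V (a i)) (w : ∀ j, V (b j)) (x : V (b 0)) :
    join hl hr v (Function.update w 0 x) = join hl hr v w := by
  refine sum_family_ext (fun i => ?_) fun j => ?_
  · rw [join_left, join_left]
  · rw [join_right, join_right, Function.update_of_ne (Fin.succ_ne_zero j)]

theorem join_update_castSucc (v : ∀ i, V (a i)) (w : ∀ j, V (b j)) (i : Fin n)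
    (x : V (a i.castSucc)) :
    join hl hr (Function.update v i.castSucc x) w =
      Function.update (join hl hr v w) (Fin.castAdd m i) (castV V (hl i).symm x) := by
  refine sum_family_ext (fun j => ?_) fun j => ?_
  · rw [join_left]
    by_cases h : j = i
    · subst h; simp
    · rw [Function.update_of_ne (fun e => h (Fin.castSucc_injective n e)),
        Function.update_of_ne (fun e => h (Fin.castAdd_injective n m e)), join_left]
  · rw [join_right, Function.update_of_ne (castAdd_lt_natAdd i j).ne', join_right]

theorem join_update_succ (v : ∀ i, V (a i)) (w : ∀ j, V (b j)) (j : Fin m)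
    (x : V (b j.succ)) :
    join hl hr v (Function.update w j.succ x) =
      Function.update (join hl hr v w) (Fin.natAdd n j) (castV V (hr j).symm x) := by
  refine sum_family_ext (fun i => ?_) fun i => ?_
  · rw [join_left, Function.update_of_ne (castAdd_lt_natAdd i j).ne, join_left]
  · rw [join_right]
    by_cases h : i = j
    · subst h; simp
    · rw [Function.update_of_ne (fun e => h (Fin.succ_injective m e)),
        Function.update_of_ne (fun e => h (Fin.natAdd_injective m n e)), join_right]

/-- The contraction of two pure tensors, as a function of the second one. -/
noncomputable def contractRight (B : V (a (Fin.last n)) →ₗ[k] V (b 0) →ₗ[k] k)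
    (v : ∀ i, V (a i)) : MultilinearMap k (fun j => (V (b j)).carrier) (T V c) :=
  MultilinearMap.mk'
    (fun w => B (v (Fin.last n)) (w 0) • PiTensorProduct.tprod k (join hl hr v w))
    (by
      intro w j x y
      induction j using Fin.cases with
      | zero => simp only [join_update_zero, Function.update_self, map_add, add_smul]
      | succ j =>
        simp only [join_update_succ, map_add, MultilinearMap.map_update_add, smul_add,
          Function.update_of_ne (Fin.succ_ne_zero j).symm])
    (by
      intro w j r x
      induction j using Fin.cases with
      | zero => simp only [join_update_zero, Function.update_self, map_smul, smul_assoc]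
      | succ j =>
        simp only [join_update_succ, map_smul, MultilinearMap.map_update_smul,
          Function.update_of_ne (Fin.succ_ne_zero j).symm]
        exact smul_comm _ _ _)

/-- The contraction of two pure tensors. -/
noncomputable def contractLeft (B : V (a (Fin.last n)) →ₗ[k] V (b 0) →ₗ[k] k) :
    MultilinearMap k (fun i => (V (a i)).carrier) (T V b →ₗ[k] T V c) :=
  MultilinearMap.mk' (fun v => PiTensorProduct.lift (contractRight hl hr B v))
    (by
      intro v i x y
      refine PiTensorProduct.ext ?_
      ext w
      simp only [LinearMap.compMultilinearMap_apply, LinearMap.add_apply,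
        PiTensorProduct.lift.tprod, contractRight, MultilinearMap.mk'_apply]
      induction i using Fin.lastCases with
      | last => simp only [join_update_last, Function.update_self, map_add, add_smul,
          LinearMap.add_apply]
      | cast i =>
        simp only [join_update_castSucc, map_add, MultilinearMap.map_update_add, smul_add,
          Function.update_of_ne (Fin.castSucc_lt_last i).ne'])
    (by
      intro v i r x
      refine PiTensorProduct.ext ?_
      ext w
      simp only [LinearMap.compMultilinearMap_apply, LinearMap.smul_apply,
        PiTensorProduct.lift.tprod, contractRight, MultilinearMap.mk'_apply]
      induction i using Fin.lastCases with
      | last => simp only [join_update_last, Function.update_self, map_smul, smul_assoc,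
          LinearMap.smul_apply]
      | cast i =>
        simp only [join_update_castSucc, map_smul, MultilinearMap.map_update_smul,
          Function.update_of_ne (Fin.castSucc_lt_last i).ne']
        exact smul_comm _ _ _)

/-- The contraction of the last factor of the first tensor with the first factor of the second
one: `(v₀ ⊗ … ⊗ vₙ) ⊗ (w₀ ⊗ … ⊗ wₘ) ↦ B(vₙ, w₀) v₀ ⊗ … ⊗ vₙ₋₁ ⊗ w₁ ⊗ … ⊗ wₘ`. -/
noncomputable def contract (B : V (a (Fin.last n)) →ₗ[k] V (b 0) →ₗ[k] k) :
    T V a →ₗ[k] T V b →ₗ[k] T V c :=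
  PiTensorProduct.lift (contractLeft hl hr B)

theorem contract_tprod (B : V (a (Fin.last n)) →ₗ[k] V (b 0) →ₗ[k] k) (v : ∀ i, V (a i))
    (w : ∀ j, V (b j)) :
    contract hl hr B (PiTensorProduct.tprod k v) (PiTensorProduct.tprod k w) =
      B (v (Fin.last n)) (w 0) • PiTensorProduct.tprod k (join hl hr v w) := by
  rw [contract, PiTensorProduct.lift.tprod]
  exact PiTensorProduct.lift.tprod w

/-- The degrees of the vectors of a joined family. -/
def joinDeg (p : Fin (n + 1) → ℤ) (q : Fin (m + 1) → ℤ) : Fin (n + m) → ℤ :=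
  Fin.addCases (fun i => p i.castSucc) (fun j => q j.succ)

@[simp] theorem joinDeg_left (p : Fin (n + 1) → ℤ) (q : Fin (m + 1) → ℤ) (i : Fin n) :
    joinDeg p q (Fin.castAdd m i) = p i.castSucc := by rw [joinDeg, Fin.addCases_left]

@[simp] theorem joinDeg_right (p : Fin (n + 1) → ℤ) (q : Fin (m + 1) → ℤ) (j : Fin m) :
    joinDeg p q (Fin.natAdd n j) = q j.succ := by rw [joinDeg, Fin.addCases_right]

theorem Homog.join {p : Fin (n + 1) → ℤ} {q : Fin (m + 1) → ℤ} {v : ∀ i, V (a i)}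
    {w : ∀ j, V (b j)} (hv : Homog V a p v) (hw : Homog V b q w) :
    Homog V c (joinDeg p q) (join hl hr v w) := by
  intro i
  induction i using Fin.addCases with
  | left i => rw [join_left, joinDeg_left]; exact castV_mem V _ (hv _)
  | right j => rw [join_right, joinDeg_right]; exact castV_mem V _ (hw _)

end comp

end TensorEnd

/-- A family of pairings between the dg vector spaces `V c`: chain maps `V c ⊗ V c' ⟶ k` of degree
`0`, symmetric in the graded sense. -/
structure FlagPairing {k : Type u} [Field k] {C : Type} (V : C → DGVect.{u} k) where
  pair : (c c' : C) → (V c →ₗ[k] V c' →ₗ[k] k)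
  degree : ∀ {c c' : C} {p q : ℤ} {x : V c} {y : V c'}, x ∈ (V c).gr p → y ∈ (V c').gr q →
    p + q ≠ 0 → pair c c' x y = 0
  symm : ∀ {c c' : C} {p q : ℤ} {x : V c} {y : V c'}, x ∈ (V c).gr p → y ∈ (V c').gr q →
    pair c c' x y = (-1 : k) ^ (p * q) • pair c' c y x
  chain : ∀ {c c' : C} {p : ℤ} {x : V c} (y : V c'), x ∈ (V c).gr p →
    pair c c' ((V c).d x) y + (-1 : k) ^ p • pair c c' x ((V c').d y) = 0

namespace TensorEnd

variable {k : Type u} [Field k] {C : Type} {V : C → DGVect.{u} k}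

theorem pair_castV (B : FlagPairing V) {c c' e e' : C} (h : c = c') (h' : e = e') (x : V c)
    (y : V e) : B.pair c' e' (castV V h x) (castV V h' y) = B.pair c e x y := by
  subst h; subst h'; rfl

theorem bilin_ext {n m : ℕ} {a : Fin n → C} {b : Fin m → C} {M : Type*} [AddCommGroup M]
    [Module k M] {f g : T V a →ₗ[k] T V b →ₗ[k] M}
    (h : ∀ p v, Homog V a p v → ∀ q w, Homog V b q w →
      f (PiTensorProduct.tprod k v) (PiTensorProduct.tprod k w) =
      g (PiTensorProduct.tprod k v) (PiTensorProduct.tprod k w)) : f = g :=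
  hom_ext fun p v hv => hom_ext fun q w hw => h p v hv q w hw

variable [FlagColour C]

variable (B : FlagPairing V)

/-- The composition of the tensors along an edge. -/
noncomputable def compT {n m : ℕ} {a : Fin (n + 1) → C} {b : Fin (m + 1) → C}
    {c : Fin (n + m) → C} (h : Composable a b c) : T V a →ₗ[k] T V b →ₗ[k] T V c :=
  contract h.left h.right (B.pair _ _)

theorem compT_tprod {n m : ℕ} {a : Fin (n + 1) → C} {b : Fin (m + 1) → C}
    {c : Fin (n + m) → C} (h : Composable a b c) (v : ∀ i, V (a i)) (w : ∀ j, V (b j)) :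
    compT B h (PiTensorProduct.tprod k v) (PiTensorProduct.tprod k w) =
      B.pair _ _ (v (Fin.last n)) (w 0) • PiTensorProduct.tprod k (join h.left h.right v w) :=
  contract_tprod h.left h.right _ v w

theorem sum_joinDeg {n m : ℕ} (p : Fin (n + 1) → ℤ) (q : Fin (m + 1) → ℤ) :
    ∑ i, joinDeg p q i + (p (Fin.last n) + q 0) = ∑ i, p i + ∑ j, q j := by
  rw [Fin.sum_univ_add, Fin.sum_univ_castSucc p, Fin.sum_univ_succ q]
  simp only [joinDeg_left, joinDeg_right]
  ring

theorem compT_mem {n m : ℕ} {a : Fin (n + 1) → C} {b : Fin (m + 1) → C}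
    {c : Fin (n + m) → C} (h : Composable a b c) {p q : ℤ} {x : T V a} {y : T V b}
    (hx : x ∈ tgr V a p) (hy : y ∈ tgr V b q) : compT B h x y ∈ tgr V c (p + q) := by
  refine mem_of_mem (f := (compT B h).flip y) (fun p' v hv hp => ?_) hx
  refine mem_of_mem (f := compT B h (PiTensorProduct.tprod k v)) (fun q' w hw hq => ?_) hy
  rw [compT_tprod]
  by_cases h0 : p' (Fin.last n) + q' 0 = 0
  · refine Submodule.smul_mem _ _ (tprod_mem (hv.join h.left h.right hw) ?_)
    have := sum_joinDeg p' q'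
    omega
  · rw [B.degree (hv _) (hw _) h0, zero_smul]
    exact Submodule.zero_mem _

theorem compT_d {n m : ℕ} {a : Fin (n + 1) → C} {b : Fin (m + 1) → C}
    {c : Fin (n + m) → C} (h : Composable a b c) {p : ℤ} {x : T V a} (y : T V b)
    (hx : x ∈ tgr V a p) :
    td V c (compT B h x y) = compT B h (td V a x) y + (-1 : k) ^ p • compT B h x (td V b y) := by
  refine ext_of_mem (f := td V c ∘ₗ (compT B h).flip y)
    (g := (compT B h).flip y ∘ₗ td V a + (-1 : k) ^ p • (compT B h).flip (td V b y))
    (fun p' v hv hp => ?_) hx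
  refine LinearMap.congr_fun (f := td V c ∘ₗ compT B h (PiTensorProduct.tprod k v))
    (g := compT B h (td V a (PiTensorProduct.tprod k v)) +
      (-1 : k) ^ p • compT B h (PiTensorProduct.tprod k v) ∘ₗ td V b)
    (hom_ext fun q w hw => ?_) y
  simp only [LinearMap.comp_apply, LinearMap.add_apply, LinearMap.smul_apply]
  rw [compT_tprod, map_smul, td_tprod (hv.join h.left h.right hw), td_tprod hv, td_tprod hw]
  simp only [map_sum, LinearMap.sum_apply, map_smul, LinearMap.smul_apply, compT_tprod]
  rw [Fin.sum_univ_add, Fin.sum_univ_castSucc (n := n), Fin.sum_univ_succ (n := m)]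
  simp only [join_update_castSucc, join_update_succ, join_update_last, join_update_zero,
    Function.update_self, Function.update_of_ne (Fin.castSucc_lt_last _).ne',
    Function.update_of_ne (Fin.succ_ne_zero _).symm, join_left, join_right, castV_d]
  have hp' : (∑ j, if j < Fin.last n then p' j else 0) = p - p' (Fin.last n) := by
    rw [← hp, Fin.sum_univ_castSucc, Fin.sum_univ_castSucc]
    simp [Fin.castSucc_lt_last]
  have hq0 : (∑ j, if j < 0 then q j else 0) = 0 := by simp
  have hE : sg k (p - p' (Fin.last n)).negOnePow • B.pair _ _ ((V _).d (v (Fin.last n))) (w 0) •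
        PiTensorProduct.tprod k (join (c := c) h.left h.right v w) +
      (-1 : k) ^ p • B.pair _ _ (v (Fin.last n)) ((V _).d (w 0)) •
        PiTensorProduct.tprod k (join (c := c) h.left h.right v w) = 0 := by
    have h1 := B.chain (w 0) (hv (Fin.last n))
    have h2 : (-1 : k) ^ p = (-1) ^ (p - p' (Fin.last n)) * (-1) ^ p' (Fin.last n) := by
      rw [← zpow_add₀ (neg_ne_zero.2 one_ne_zero), sub_add_cancel]
    rw [h2, sg_negOnePow, mul_smul, ← smul_add, smul_smul ((-1 : k) ^ p' (Fin.last n)), ← add_smul,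
      ← smul_eq_mul, h1, zero_smul, smul_zero]
  rw [hp', hq0, Int.negOnePow_zero, sg_one, one_smul, smul_add, smul_add ((-1 : k) ^ p)]
  rw [show ∀ A1 A2 A3 A4 : T V c, A1 + A2 + (A3 + A4) = (A2 + A3) + (A1 + A4) from
    fun _ _ _ _ => by abel, hE, zero_add]
  rw [Finset.smul_sum, Finset.smul_sum, Finset.smul_sum]
  congr 1
  · refine Finset.sum_congr rfl fun i _ => ?_
    rw [smul_comm]
    congr 3
    rw [Fin.sum_univ_add, Fin.sum_univ_castSucc]
    have h1 : ∀ j : Fin m, ¬ Fin.natAdd n j < Fin.castAdd m i :=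
      fun j => (castAdd_lt_natAdd i j).not_gt
    simp [h1, castAdd_lt_castAdd, (Fin.castSucc_lt_last i).not_gt]
  · refine Finset.sum_congr rfl fun i _ => ?_
    by_cases h0 : p' (Fin.last n) + q 0 = 0
    · rw [smul_comm, smul_smul ((-1 : k) ^ p), ← sg_negOnePow, ← sg_mul, ← Int.negOnePow_add]
      congr 3
      rw [Fin.sum_univ_add, Fin.sum_univ_succ, ← hp, Fin.sum_univ_castSucc]
      simp [castAdd_lt_natAdd]
      omega
    · rw [B.degree (hv _) (hw _) h0]
      simp

theorem compT_map {n m n' m' : ℕ} (σ : Fin n ≃ Fin n') (τ : Fin m ≃ Fin m')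
    {a : Fin (n + 1) → C} {b : Fin (m + 1) → C} {c : Fin (n + m) → C}
    {a' : Fin (n' + 1) → C} {b' : Fin (m' + 1) → C} {c' : Fin (n' + m') → C}
    (ha : ∀ i, a' (extendLast σ i) = a i) (hb : ∀ i, b' (extendFirst τ i) = b i)
    (hc : ∀ i, c' (blockSum σ τ i) = c i) (h : Composable a b c) (h' : Composable a' b' c')
    (x : T V a) (y : T V b) :
    compT B h' (act V (extendLast σ) ha x) (act V (extendFirst τ) hb y) =
      act V (blockSum σ τ) hc (compT B h x y) := by
  have : (compT B h').compl₁₂ (act V (extendLast σ) ha) (act V (extendFirst τ) hb) =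
      (compT B h).compr₂ (act V (blockSum σ τ) hc) := by
    refine bilin_ext fun p v hv q w hw => ?_
    rw [LinearMap.compl₁₂_apply, LinearMap.compr₂_apply, act_tprod _ ha hv, act_tprod _ hb hw,
      compT_tprod, map_smul (act V (blockSum σ τ) hc),
      act_tprod _ hc (hv.join h.left h.right hw), map_smul,
      map_smul, LinearMap.smul_apply, compT_tprod, koszulSign_extendLast,
      koszulSign_extendFirst, koszulSign_blockSum, smul_comm (B.pair _ _ _ _), smul_smul,
      ← sg_mul, mul_comm]
    simp only [joinDeg_left, joinDeg_right]
    congr 1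
    have e1 : permV (extendLast σ) ha v (Fin.last n') =
        castV V (by rw [← ha, extendLast_last]) (v (Fin.last n)) := by
      rw [← castV_castV V (ha _).symm (by rw [extendLast_last]), ← permV_apply]
      exact (castV_apply V _ (extendLast_last σ) _).symm
    have e2 : permV (extendFirst τ) hb w 0 =
        castV V (by rw [← hb, extendFirst_zero]) (w 0) := by
      rw [← castV_castV V (hb _).symm (by rw [extendFirst_zero]), ← permV_apply]
      exact (castV_apply V _ (extendFirst_zero τ) _).symm
    rw [e1, e2, pair_castV]
    congr 2
    refine family_ext (blockSum σ τ) fun i => ?_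
    rw [permV_apply]
    induction i using Fin.addCases with
    | left i =>
      rw [join_left, castV_castV, ← castV_apply V (join h'.left h'.right _ _)
        (blockSum_castAdd σ τ i).symm (by rw [blockSum_castAdd]), join_left, castV_castV,
        ← castV_apply V (permV (extendLast σ) ha v) (extendLast_castSucc σ i)
        (by rw [extendLast_castSucc]), permV_apply, castV_castV, castV_castV]
    | right i =>
      rw [join_right, castV_castV, ← castV_apply V (join h'.left h'.right _ _)
        (blockSum_natAdd σ τ i).symm (by rw [blockSum_natAdd]), join_right, castV_castV,
        ← castV_apply V (permV (extendFirst τ) hb w) (extendFirst_succ τ i)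
        (by rw [extendFirst_succ]), permV_apply, castV_castV, castV_castV]
  exact LinearMap.congr_fun (LinearMap.congr_fun this x) y

end TensorEnd

namespace TensorEnd

variable {k : Type u} [Field k] {C : Type} {V : C → DGVect.{u} k}

theorem permV_eq {n m : ℕ} (σ : Fin n ≃ Fin m) {c : Fin n → C} {c' : Fin m → C}
    (h : ∀ i, c' (σ i) = c i) (v : ∀ i, V (c i)) {i : Fin n} {j : Fin m} (hij : σ i = j)
    (h' : c i = c' j) : permV σ h v j = castV V h' (v i) := by
  subst hij
  exact permV_apply σ h v i

theorem family_eq {n : ℕ} {c : Fin n → C} (v : ∀ i, V (c i)) {i j : Fin n} (h : i = j)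
    (h' : c j = c i) : v i = castV V h' (v j) := by
  subst h
  rfl

variable (B : FlagPairing V)

theorem compT_comm [FlagColour C] {n m : ℕ} {a : Fin (n + 1) → C} {b : Fin (m + 1) → C} {c : Fin (n + m) → C}
    {a' : Fin (n + 1) → C} {b' : Fin (m + 1) → C} {c' : Fin (m + n) → C}
    (ha : ∀ i, a' (finRotate (n + 1) i) = a i) (hb : ∀ i, b' ((finRotate (m + 1)).symm i) = b i)
    (hc : ∀ i, c' (finAddFlip i) = c i) (h : Composable a b c) (h' : Composable b' a' c')
    {p q : ℤ} {x : T V a} {y : T V b} (hx : x ∈ tgr V a p) (hy : y ∈ tgr V b q) :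
    compT B h' (act V (finRotate (m + 1)).symm hb y) (act V (finRotate (n + 1)) ha x) =
      (-1 : k) ^ (p * q) • act V finAddFlip hc (compT B h x y) := by
  refine ext_of_mem
    (f := compT B h' (act V (finRotate (m + 1)).symm hb y) ∘ₗ act V (finRotate (n + 1)) ha)
    (g := (-1 : k) ^ (p * q) • (act V finAddFlip hc ∘ₗ (compT B h).flip y))
    (fun p' v hv hp => ?_) hx
  refine ext_of_mem
    (f := (compT B h').flip (act V (finRotate (n + 1)) ha (PiTensorProduct.tprod k v)) ∘ₗ
      act V (finRotate (m + 1)).symm hb)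
    (g := (-1 : k) ^ (p * q) • (act V finAddFlip hc ∘ₗ compT B h (PiTensorProduct.tprod k v)))
    (fun q' w hw hq => ?_) hy
  simp only [LinearMap.comp_apply, LinearMap.smul_apply, LinearMap.flip_apply]
  rw [act_tprod _ ha hv, act_tprod _ hb hw, map_smul, map_smul, LinearMap.smul_apply,
    compT_tprod, compT_tprod, map_smul, act_tprod _ hc (hv.join h.left h.right hw),
    koszulSign_rotate, koszulSign_rotate_symm, koszulSign_flip]
  simp only [joinDeg_left, joinDeg_right]
  have hj : permV finAddFlip hc (join h.left h.right v w) =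
      join h'.left h'.right (permV (finRotate (m + 1)).symm hb w)
        (permV (finRotate (n + 1)) ha v) := by
    refine family_ext finAddFlip fun i => ?_
    rw [permV_apply]
    induction i using Fin.addCases with
    | left i =>
      rw [join_left, castV_castV, family_eq (join h'.left h'.right _ _)
        (finAddFlip_apply_castAdd i m) (by rw [finAddFlip_apply_castAdd]), join_right,
        permV_eq (finRotate (n + 1)) ha v (finRotate_castSucc i)
          (by rw [← ha, finRotate_castSucc]), castV_castV, castV_castV]
    | right i =>
      rw [join_right, castV_castV, family_eq (join h'.left h'.right _ _)
        (finAddFlip_apply_natAdd i n) (by rw [finAddFlip_apply_natAdd]), join_left,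
        permV_eq (finRotate (m + 1)).symm hb w (finRotate_symm_succ i)
          (by rw [← hb, finRotate_symm_succ]), castV_castV, castV_castV]
  have e1 : permV (finRotate (m + 1)).symm hb w (Fin.last m) =
      castV V (by rw [← hb, finRotate_symm_zero]) (w 0) :=
    permV_eq _ hb w finRotate_symm_zero _
  have e2 : permV (finRotate (n + 1)) ha v 0 =
      castV V (by rw [← ha, finRotate_last]) (v (Fin.last n)) :=
    permV_eq _ ha v finRotate_last _
  rw [hj, e1, e2, pair_castV]
  by_cases h0 : p' (Fin.last n) + q' 0 = 0
  · rw [B.symm (hv _) (hw _), ← sg_negOnePow, ← sg_negOnePow, smul_eq_mul]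
    simp only [smul_smul]
    congr 1
    have hE : (p' (Fin.last n) * ∑ i : Fin n, p' i.castSucc).negOnePow *
        (q' 0 * ∑ i : Fin m, q' i.succ).negOnePow = (p * q).negOnePow *
        (p' (Fin.last n) * q' 0).negOnePow *
        ((∑ i : Fin n, p' i.castSucc) * ∑ i : Fin m, q' i.succ).negOnePow := by
      rw [← Int.negOnePow_add, ← Int.negOnePow_add, ← Int.negOnePow_add, Int.negOnePow_eq_iff,
        ← hp, ← hq, Fin.sum_univ_castSucc, Fin.sum_univ_succ q']
      obtain hy : q' 0 = - p' (Fin.last n) := by omega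
      rw [hy]
      generalize (∑ i : Fin n, p' i.castSucc) = r
      generalize (∑ i : Fin m, q' i.succ) = s
      generalize p' (Fin.last n) = z
      refine ⟨z * r - z * s + z * z - r * s, by ring⟩
    have hE' := congrArg (sg k) hE
    simp only [sg_mul] at hE'
    linear_combination (B.pair (b 0) (a (Fin.last n)) (w 0) (v (Fin.last n))) * hE'
  · have h0' : q' 0 + p' (Fin.last n) ≠ 0 := by omega
    rw [B.degree (hv _) (hw _) h0, B.degree (hw _) (hv _) h0']
    simp

theorem act_finCongr {n m : ℕ} (e : n = m) {c : Fin n → C} {c' : Fin m → C}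
    (h : ∀ i, c' (finCongr e i) = c i) (v : ∀ i, V (c i)) :
    act V (finCongr e) h (PiTensorProduct.tprod k v) =
      PiTensorProduct.tprod k (permV (finCongr e) h v) := by
  have : act V (finCongr e) h = permT V (finCongr e) h := by
    refine hom_ext fun p v hv => ?_
    rw [act_tprod _ h hv, permT_tprod, koszulSign_of_strictMono _ (fun _ _ h => h), sg_one,
      one_smul]
  rw [this, permT_tprod]

theorem join_eq_left {n m : ℕ} {a : Fin (n + 1) → C} {b : Fin (m + 1) → C} {c : Fin (n + m) → C}
    (hl : ∀ i : Fin n, c (Fin.castAdd m i) = a i.castSucc)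
    (hr : ∀ j : Fin m, c (Fin.natAdd n j) = b j.succ) (v : ∀ i, V (a i)) (w : ∀ j, V (b j))
    (i : Fin (n + m)) (j : Fin (n + 1)) (hij : i.val = j.val) (hj : j.val < n) :
    ∃ h' : a j = c i, join hl hr v w i = castV V h' (v j) := by
  obtain rfl : i = Fin.castAdd m ⟨j.val, hj⟩ := Fin.ext hij
  exact ⟨(hl ⟨j.val, hj⟩).symm, join_left hl hr v w ⟨j.val, hj⟩⟩

theorem join_eq_right {n m : ℕ} {a : Fin (n + 1) → C} {b : Fin (m + 1) → C} {c : Fin (n + m) → C}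
    (hl : ∀ i : Fin n, c (Fin.castAdd m i) = a i.castSucc)
    (hr : ∀ j : Fin m, c (Fin.natAdd n j) = b j.succ) (v : ∀ i, V (a i)) (w : ∀ j, V (b j))
    (i : Fin (n + m)) (j : Fin (m + 1)) (hij : i.val + 1 = n + j.val) (hi : n ≤ i.val) :
    ∃ h' : b j = c i, join hl hr v w i = castV V h' (w j) := by
  obtain ⟨i', rfl⟩ : ∃ i' : Fin m, i = Fin.natAdd n i' :=
    ⟨⟨i.val - n, by omega⟩, Fin.ext (by simp; omega)⟩
  obtain rfl : j = i'.succ := Fin.ext (by simp at hij ⊢; omega)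
  exact ⟨(hr i').symm, join_right hl hr v w i'⟩

theorem permV_finCongr {n m : ℕ} (e : n = m) {c : Fin n → C} {c' : Fin m → C}
    (h : ∀ i, c' (finCongr e i) = c i) (v : ∀ i, V (c i)) (i : Fin n) (j : Fin m)
    (hij : i.val = j.val) : ∃ h' : c i = c' j, permV (finCongr e) h v j = castV V h' (v i) := by
  obtain rfl : finCongr e i = j := Fin.ext hij
  exact ⟨(h i).symm, permV_apply _ h v i⟩

theorem pair_castV_left {c c' e : C} (h : c = c') (x : V c) (y : V e) :
    B.pair c' e (castV V h x) y = B.pair c e x y := by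
  subst h; rfl

theorem pair_castV_right {c e e' : C} (h : e = e') (x : V c) (y : V e) :
    B.pair c e' x (castV V h y) = B.pair c e x y := by
  subst h; rfl

theorem compT_assoc [FlagColour C] {n m l : ℕ} {a : Fin (n + 1) → C} {b : Fin (m + 1 + 1) → C}
    {c : Fin (l + 1) → C} {ab : Fin (n + m + 1) → C} {bc : Fin (m + 1 + l) → C}
    {bc' : Fin (m + l + 1) → C} {abc : Fin (n + m + l) → C} {abc' : Fin (n + (m + l)) → C}
    (hab : Composable (m := m + 1) a b ab) (habc : Composable ab c abc)
    (hbc : Composable (n := m + 1) b c bc)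
    (hr : ∀ i, bc' (finCongr (by omega : m + 1 + l = m + l + 1) i) = bc i)
    (habc' : Composable (m := m + l) a bc' abc')
    (hs : ∀ i, abc' (finCongr (Nat.add_assoc n m l) i) = abc i)
    (x : T V a) (y : T V b) (z : T V c) :
    act V (finCongr (Nat.add_assoc n m l)) hs (compT B habc (compT B (m := m + 1) hab x y) z) =
      compT B (m := m + l) habc' x
        (act V (finCongr (by omega)) hr (compT B (n := m + 1) hbc y z)) := by
  induction x using PiTensorProduct.induction_on with
  | add x x' hx hx' => simp only [map_add, LinearMap.add_apply, hx, hx']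
  | smul_tprod r v =>
  induction y using PiTensorProduct.induction_on with
  | add x x' hx hx' => simp only [map_add, LinearMap.add_apply, hx, hx']
  | smul_tprod s w =>
  induction z using PiTensorProduct.induction_on with
  | add x x' hx hx' => simp only [map_add, hx, hx']
  | smul_tprod t u =>
  have hj : permV (finCongr (Nat.add_assoc n m l)) hs (join habc.left habc.right
      (join (m := m + 1) hab.left hab.right v w) u) =
      join (m := m + l) habc'.left habc'.right v
        (permV (finCongr (by omega)) hr (join (n := m + 1) hbc.left hbc.right w u)) := by
    refine family_ext (finCongr (Nat.add_assoc n m l)) fun i => ?_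
    rw [permV_apply]
    have hi := i.isLt
    by_cases h1 : i.val < n + m
    · obtain ⟨h1', e1⟩ := join_eq_left habc.left habc.right
        (join (m := m + 1) hab.left hab.right v w) u i ⟨i.val, by omega⟩ rfl h1
      by_cases h2 : i.val < n
      · obtain ⟨h2', e2⟩ := join_eq_left (m := m + 1) hab.left hab.right v w
          ⟨i.val, by omega⟩ ⟨i.val, by omega⟩ rfl h2
        obtain ⟨h3', e3⟩ := join_eq_left (m := m + l) habc'.left habc'.right v
          (permV (finCongr (by omega)) hr (join (n := m + 1) hbc.left hbc.right w u))
          (finCongr (Nat.add_assoc n m l) i) ⟨i.val, by omega⟩ rfl h2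
        rw [e1, e2, e3, castV_castV, castV_castV]
      · obtain ⟨h2', e2⟩ := join_eq_right (m := m + 1) hab.left hab.right v w
          ⟨i.val, by omega⟩ ⟨i.val - n + 1, by omega⟩ (by simp only; omega) (by simp only; omega)
        obtain ⟨h3', e3⟩ := join_eq_right (m := m + l) habc'.left habc'.right v
          (permV (finCongr (by omega)) hr (join (n := m + 1) hbc.left hbc.right w u))
          (finCongr (Nat.add_assoc n m l) i) ⟨i.val - n + 1, by omega⟩
          (by simp only [finCongr_apply_coe]; omega) (by simp only [finCongr_apply_coe]; omega)
        obtain ⟨h4', e4⟩ := permV_finCongr (by omega) hr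
          (join (n := m + 1) hbc.left hbc.right w u) ⟨i.val - n + 1, by omega⟩
          ⟨i.val - n + 1, by omega⟩ rfl
        obtain ⟨h5', e5⟩ := join_eq_left (n := m + 1) hbc.left hbc.right w u
          ⟨i.val - n + 1, by omega⟩ ⟨i.val - n + 1, by omega⟩ rfl (by simp only; omega)
        rw [e1, e2, e3, e4, e5]
        simp only [castV_castV]
    · obtain ⟨h1', e1⟩ := join_eq_right habc.left habc.right
        (join (m := m + 1) hab.left hab.right v w) u i ⟨i.val - (n + m) + 1, by omega⟩
        (by simp only; omega) (by omega)
      obtain ⟨h3', e3⟩ := join_eq_right (m := m + l) habc'.left habc'.right v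
        (permV (finCongr (by omega)) hr (join (n := m + 1) hbc.left hbc.right w u))
        (finCongr (Nat.add_assoc n m l) i) ⟨i.val - n + 1, by omega⟩
        (by simp only [finCongr_apply_coe]; omega) (by simp only [finCongr_apply_coe]; omega)
      obtain ⟨h4', e4⟩ := permV_finCongr (by omega) hr
        (join (n := m + 1) hbc.left hbc.right w u) ⟨i.val - n + 1, by omega⟩
        ⟨i.val - n + 1, by omega⟩ rfl
      obtain ⟨h5', e5⟩ := join_eq_right (n := m + 1) hbc.left hbc.right w u
        ⟨i.val - n + 1, by omega⟩ ⟨i.val - (n + m) + 1, by omega⟩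
        (by simp only; omega) (by simp only; omega)
      rw [e1, e3, e4, e5]
      simp only [castV_castV]
  obtain ⟨h1, e1⟩ := join_eq_right (m := m + 1) hab.left hab.right v w (Fin.last (n + m))
    (Fin.last (m + 1)) (by simp; omega) (by simp)
  obtain ⟨h2, e2⟩ := permV_finCongr (by omega) hr (join (n := m + 1) hbc.left hbc.right w u)
    ⟨0, by omega⟩ 0 rfl
  obtain ⟨h3, e3⟩ := join_eq_left (n := m + 1) hbc.left hbc.right w u ⟨0, by omega⟩ 0 rfl
    (by simp)
  simp only [map_smul, LinearMap.smul_apply, compT_tprod, act_finCongr]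
  rw [hj, e1, e2, e3, pair_castV_left, castV_castV, pair_castV_right]
  simp only [smul_smul]
  congr 1
  ring

end TensorEnd

/-- The operad of tensors: operations on a corolla with flags coloured by `c` are the elements of
`⨂ i, V (c i)`, bijections permute the factors (with Koszul signs), and two tensors are composed by
contracting the factors at the flags that are glued with the pairing `B`. -/
noncomputable def tensorOperad {k : Type u} [Field k] {C : Type} [FlagColour C]
    (V : C → DGVect.{u} k) (B : FlagPairing V) : FlagOperad k C where
  obj _ c := TensorEnd.tensor V c
  map σ _ _ h := TensorEnd.act V σ h
  map_mem σ _ _ h _ _ hx := TensorEnd.act_mem σ h hx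
  map_d σ _ _ h x := TensorEnd.act_td σ h x
  map_refl h x := TensorEnd.act_refl h x
  map_trans σ τ _ _ _ h h' h'' x := TensorEnd.act_trans σ τ h h' h'' x
  comp h := TensorEnd.compT B h
  comp_mem h _ _ _ _ hx hy := TensorEnd.compT_mem B h hx hy
  comp_d h _ _ y hx := TensorEnd.compT_d B h y hx
  comp_map σ τ _ _ _ _ _ _ ha hb hc h h' x y := TensorEnd.compT_map B σ τ ha hb hc h h' x y
  comp_comm ha hb hc h h' _ _ _ _ hx hy := TensorEnd.compT_comm B ha hb hc h h' hx hy
  comp_assoc hab habc hbc hr habc' hs x y z :=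
    TensorEnd.compT_assoc B hab habc hbc hr habc' hs x y z

/-! ### Endomorphism operads -/

/-- A symmetric (in the graded sense) non-degenerate bilinear form of degree `0` on a dg vector
space, compatible with the differential. -/
structure SymmetricForm {k : Type u} [Field k] (V : DGVect.{u} k) where
  form : V →ₗ[k] V →ₗ[k] k
  degree : ∀ {p q : ℤ} {x y : V}, x ∈ V.gr p → y ∈ V.gr q → p + q ≠ 0 → form x y = 0
  symm : ∀ {p q : ℤ} {x y : V}, x ∈ V.gr p → y ∈ V.gr q →
    form x y = (-1 : k) ^ (p * q) • form y x
  chain : ∀ {p : ℤ} {x : V} (y : V), x ∈ V.gr p →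
    form (V.d x) y + (-1 : k) ^ p • form x (V.d y) = 0
  nondegenerate : ∀ x, (∀ y, form x y = 0) → x = 0

/-- The endomorphism cyclic operad of a dg vector space with a symmetric form:
`End((n)) = V ^ ⊗ n`, and operations are composed by contraction with the form.  (If `V` is finite
dimensional and `n` is positive, the form identifies this space with `Hom(V ^ ⊗ (n - 1), V)`.) -/
noncomputable def EndCyc {k : Type u} [Field k] (V : DGVect.{u} k) (B : SymmetricForm V) :
    CyclicOperad k :=
  tensorOperad (fun _ : Unit => V)
    { pair := fun _ _ => B.form
      degree := fun hx hy h => B.degree hx hy h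
      symm := fun hx hy => B.symm hx hy
      chain := fun y hx => B.chain y hx }

namespace DGVect

variable {k : Type u} [Field k] (A : DGVect.{u} k)

/-- The evaluation `ξ ⊗ x ↦ ξ(x)`. -/
def ev : A.dual →ₗ[k] A →ₗ[k] k := A.dualIncl

/-- The evaluation in the other order, `x ⊗ ξ ↦ (-1)^(|x| |ξ|) ξ(x)`.  Since `ξ(x)` vanishes unless
`|ξ| = -|x|`, the sign is `(-1)^|x|`. -/
noncomputable def coev : A →ₗ[k] A.dual →ₗ[k] k := A.ev.flip ∘ₗ A.eps

theorem ev_degree {p q : ℤ} {ξ : A.dual} {x : A} (hξ : ξ ∈ A.dual.gr p) (hx : x ∈ A.gr q)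
    (h : p + q ≠ 0) : A.ev ξ x = 0 := hξ q (by omega) x hx

theorem coev_degree {p q : ℤ} {x : A} {ξ : A.dual} (hx : x ∈ A.gr p) (hξ : ξ ∈ A.dual.gr q)
    (h : p + q ≠ 0) : A.coev x ξ = 0 :=
  A.ev_degree hξ (A.eps_mem hx) (by omega)

theorem coev_eq {p q : ℤ} {x : A} {ξ : A.dual} (hx : x ∈ A.gr p) (hξ : ξ ∈ A.dual.gr q) :
    A.coev x ξ = (-1 : k) ^ (p * q) • A.ev ξ x := by
  by_cases h : p + q = 0
  · obtain rfl : q = -p := by omega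
    change A.ev ξ (A.eps x) = _
    rw [A.eps_of_mem hx, map_smul]
    congr 1
    rw [← TensorEnd.sg_negOnePow, ← TensorEnd.sg_negOnePow]
    congr 1
    rw [Int.negOnePow_eq_iff]
    have := Int.even_mul_succ_self p
    rw [show p - p * -p = p * (p + 1) by ring]
    exact this
  · rw [A.coev_degree hx hξ h, A.ev_degree hξ hx (by omega), smul_zero]

theorem ev_eq {p q : ℤ} {ξ : A.dual} {x : A} (hξ : ξ ∈ A.dual.gr p) (hx : x ∈ A.gr q) :
    A.ev ξ x = (-1 : k) ^ (p * q) • A.coev x ξ := by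
  rw [A.coev_eq hx hξ, smul_smul, mul_comm q p, ← mul_zpow]
  simp

theorem ev_d (ξ : A.dual) (x : A) : A.ev (A.dual.d ξ) x = A.ev ξ (A.d (A.eps x)) := rfl

theorem ev_chain {p : ℤ} {ξ : A.dual} (x : A) (hξ : ξ ∈ A.dual.gr p) :
    A.ev (A.dual.d ξ) x + (-1 : k) ^ p • A.ev ξ (A.d x) = 0 := by
  have : A.ev ξ ∘ₗ A.d ∘ₗ A.eps + (-1 : k) ^ p • (A.ev ξ ∘ₗ A.d) = 0 := by
    refine A.hom_ext fun q x hx => ?_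
    simp only [LinearMap.add_apply, LinearMap.comp_apply, LinearMap.smul_apply,
      LinearMap.zero_apply]
    rw [A.eps_of_mem hx, map_smul, map_smul, ← add_smul]
    by_cases h : p + (q + 1) = 0
    · obtain rfl : p = -(q + 1) := by omega
      rw [zpow_neg, ← inv_zpow, zpow_add_one₀ (by simp)]
      simp
    · rw [A.ev_degree hξ (A.d_mem hx) h, smul_zero]
  exact LinearMap.congr_fun this x

theorem eps_eps (x : A) : A.eps (A.eps x) = x := by
  have : A.eps ∘ₗ A.eps = LinearMap.id := by
    refine A.hom_ext fun p x hx => ?_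
    rw [LinearMap.comp_apply, A.eps_of_mem hx, map_smul, A.eps_of_mem hx, smul_smul, ← mul_zpow]
    simp
  exact LinearMap.congr_fun this x

theorem coev_chain {p : ℤ} {x : A} (ξ : A.dual) (hx : x ∈ A.gr p) :
    A.coev (A.d x) ξ + (-1 : k) ^ p • A.coev x (A.dual.d ξ) = 0 := by
  change A.ev ξ (A.eps (A.d x)) + (-1 : k) ^ p • A.ev ξ (A.d (A.eps (A.eps x))) = 0
  rw [A.eps_eps, A.eps_of_mem (A.d_mem hx), map_smul, ← add_smul, zpow_add_one₀ (by simp)]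
  simp

/-- Homogeneous functionals separate points. -/
theorem eq_zero_of_ev (x : A) (h : ∀ ξ, A.ev ξ x = 0) : x = 0 := by
  let b := A.isInternal.collectedBasis fun q => Module.Basis.ofVectorSpace k (A.gr q)
  refine b.ext_elem fun i => ?_
  have hi : b.coord i ∈ A.dualGr (-i.1) := fun q hq y hy =>
    A.isInternal.collectedBasis_repr_of_mem_ne _ (by omega) hy
  rw [map_zero]
  exact h ⟨b.coord i, A.dualGr_le _ hi⟩

/-- The double `d(A) = A ⊕ A*`. -/
noncomputable def double : DGVect k := A.prod A.dual

/-- The hyperbolic form on the double, `⟨a ⊕ η, b ⊕ ξ⟩ = η(b) + ξ(a)`, where the second term carries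
the Koszul sign `(-1)^(|a| |ξ|)`. -/
noncomputable def hyperbolicForm : SymmetricForm A.double where
  form := A.ev.compl₁₂ (LinearMap.snd k A A.dual) (LinearMap.fst k A A.dual) +
    A.coev.compl₁₂ (LinearMap.fst k A A.dual) (LinearMap.snd k A A.dual)
  degree := by
    rintro p q ⟨a, η⟩ ⟨b, ξ⟩ ⟨ha, hη⟩ ⟨hb, hξ⟩ h
    change A.ev η b + A.coev a ξ = 0
    rw [A.ev_degree hη hb h, A.coev_degree ha hξ h, add_zero]
  symm := by
    rintro p q ⟨a, η⟩ ⟨b, ξ⟩ ⟨ha, hη⟩ ⟨hb, hξ⟩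
    change A.ev η b + A.coev a ξ = (-1 : k) ^ (p * q) • (A.ev ξ a + A.coev b η)
    rw [A.ev_eq hη hb, A.coev_eq ha hξ, smul_add, add_comm]
  chain := by
    rintro p ⟨a, η⟩ ⟨b, ξ⟩ ⟨ha, hη⟩
    change A.ev (A.dual.d η) b + A.coev (A.d a) ξ +
      (-1 : k) ^ p • (A.ev η (A.d b) + A.coev a (A.dual.d ξ)) = 0
    rw [smul_add, add_add_add_comm, A.ev_chain b hη, A.coev_chain ξ ha, add_zero]
  nondegenerate := by
    rintro ⟨a, η⟩ h
    have h1 : ∀ b ξ, A.ev η b + A.coev a ξ = 0 := fun b ξ => h (b, ξ)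
    have hη : η = 0 := by
      refine A.dualIncl_injective (LinearMap.ext fun b => ?_)
      have := h1 b 0
      rw [map_zero, add_zero] at this
      exact this
    have ha : a = 0 := by
      rw [← A.eps_eps a, A.eq_zero_of_ev (A.eps a) fun ξ => ?_, map_zero]
      have := h1 0 ξ
      rw [map_zero, zero_add] at this
      exact this
    rw [ha, hη]
    rfl

/-- The dg vector space at a flag: `A` at an output and `A*` at an input. -/
noncomputable def flag : Dir → DGVect k
  | .input => A.dual
  | .output => A

/-- The pairings between the dg vector spaces at the two halves of an edge: evaluation for an input
and an output (two flags of the same direction are never glued). -/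
noncomputable def flagPairing : FlagPairing A.flag where
  pair
    | .input, .output => A.ev
    | .output, .input => A.coev
    | .input, .input => 0
    | .output, .output => 0
  degree := by
    rintro (_ | _) (_ | _) p q x y hx hy h
    · rfl
    · exact A.ev_degree hx hy h
    · exact A.coev_degree hx hy h
    · rfl
  symm := by
    rintro (_ | _) (_ | _) p q x y hx hy
    · exact (smul_zero _).symm
    · exact A.ev_eq hx hy
    · exact A.coev_eq hx hy
    · exact (smul_zero _).symm
  chain := by
    rintro (_ | _) (_ | _) p x y hx
    · simp
    · exact A.ev_chain y hx
    · exact A.coev_chain y hx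
    · simp

end DGVect

/-- The endomorphism dioperad of a dg vector space of finite type: an operation with `r` outputs and
`s` inputs is an element of `A ^ ⊗ r ⊗ (A*) ^ ⊗ s`, with one factor for every flag, and operations
are composed by evaluation.  If `A` is finite dimensional these are the maps `A ^ ⊗ s ⟶ A ^ ⊗ r`,
composed along one output and one input. -/
noncomputable def EndDi {k : Type u} [Field k] (A : DGVect.{u} k) : Dioperad k :=
  tensorOperad A.flag A.flagPairing

/-! ### The functor from dioperads to cyclic operads -/

theorem Dir.flip_ne (b : Dir) : b ≠ b.flip := by cases b <;> decide

namespace LShriek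

variable {k : Type u} [Field k]

/-- Adding a last flag of direction `b` to the corolla with the flags of `c` at its first `n`
places. -/
def snocDir {n m : ℕ} (c : Fin (n + m) → Dir) (b : Dir) : Fin (n + 1) → Dir :=
  Fin.snoc (fun i => c (Fin.castAdd m i)) b

/-- Adding a first flag of direction `b` to the corolla with the flags of `c` at its last `m`
places. -/
def consDir {n m : ℕ} (c : Fin (n + m) → Dir) (b : Dir) : Fin (m + 1) → Dir :=
  Fin.cons b fun j => c (Fin.natAdd n j)

theorem composable {n m : ℕ} (c : Fin (n + m) → Dir) (b : Dir) :
    Composable (snocDir c b) (consDir c b.flip) c where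
  glue := by
    rw [snocDir, consDir, Fin.snoc_last, Fin.cons_zero]
    exact b.flip_ne
  left i := by rw [snocDir, Fin.snoc_castSucc]
  right j := by rw [consDir, Fin.cons_succ]

/-- The action of bijections on families of operations. -/
noncomputable def mapFam (P : Dioperad k) {n m : ℕ} (σ : Fin n ≃ Fin m) :
    (∀ c, P.obj n c) →ₗ[k] (∀ c, P.obj m c) :=
  LinearMap.pi fun c => P.map σ (fun _ => rfl) ∘ₗ LinearMap.proj (fun i => c (σ i))

/-- The composition of families of operations: the sum over the two directions of the new edge. -/
noncomputable def compFam (P : Dioperad k) (n m : ℕ) :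
    (∀ c, P.obj (n + 1) c) →ₗ[k] (∀ c, P.obj (m + 1) c) →ₗ[k] (∀ c, P.obj (n + m) c) :=
  LinearMap.mk₂ k
    (fun f g c => ∑ b : Dir, P.comp (composable c b) (f (snocDir c b)) (g (consDir c b.flip)))
    (by intro f f' g; ext c; simp [Finset.sum_add_distrib])
    (by intro r f g; ext c; simp [Finset.smul_sum])
    (by intro f g g'; ext c; simp [Finset.sum_add_distrib])
    (by intro r f g; ext c; simp [Finset.smul_sum])

theorem mapFam_apply (P : Dioperad k) {n m : ℕ} (σ : Fin n ≃ Fin m) (f : ∀ c, P.obj n c)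
    (c : Fin m → Dir) : mapFam P σ f c = P.map σ (fun _ => rfl) (f fun i => c (σ i)) := rfl

theorem compFam_apply (P : Dioperad k) {n m : ℕ} (f : ∀ c, P.obj (n + 1) c)
    (g : ∀ c, P.obj (m + 1) c) (c : Fin (n + m) → Dir) :
    compFam P n m f g c =
      ∑ b : Dir, P.comp (composable c b) (f (snocDir c b)) (g (consDir c b.flip)) := rfl

/-- `mapFam` computed with another description of the colouring. -/
theorem mapFam_eq (P : Dioperad k) {n m : ℕ} (σ : Fin n ≃ Fin m) (f : ∀ c, P.obj n c)
    {c : Fin n → Dir} {c' : Fin m → Dir} (h : ∀ i, c' (σ i) = c i) :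
    mapFam P σ f c' = P.map σ h (f c) := by
  obtain rfl : c = fun i => c' (σ i) := funext fun i => (h i).symm
  rfl

/-- The summands of `compFam` computed with another description of the colourings. -/
theorem comp_eq (P : Dioperad k) {n m : ℕ} (f : ∀ c, P.obj (n + 1) c) (g : ∀ c, P.obj (m + 1) c)
    {c : Fin (n + m) → Dir} {a a' : Fin (n + 1) → Dir} {b b' : Fin (m + 1) → Dir}
    (h : Composable a b c) (h' : Composable a' b' c) (ha : a = a') (hb : b = b') :
    P.comp h (f a) (g b) = P.comp h' (f a') (g b') := by
  subst ha; subst hb; rfl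

theorem congr_arg_comp (P : Dioperad k) {n m : ℕ} (g : ∀ c, P.obj (m + 1) c)
    {c : Fin (n + m) → Dir} {a : Fin (n + 1) → Dir} {b b' : Fin (m + 1) → Dir} (x : P.obj _ a)
    (h : Composable a b c) (h' : Composable a b' c) (hb : b = b') :
    P.comp h x (g b) = P.comp h' x (g b') := by
  subst hb; rfl

theorem snocDir_extendLast {n n' m m' : ℕ} (σ : Fin n ≃ Fin n') (τ : Fin m ≃ Fin m')
    (c : Fin (n' + m') → Dir) (b : Dir) (i : Fin (n + 1)) :
    snocDir c b (extendLast σ i) = snocDir (fun j => c (blockSum σ τ j)) b i := by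
  induction i using Fin.lastCases with
  | last => rw [extendLast_last, snocDir, snocDir, Fin.snoc_last, Fin.snoc_last]
  | cast i =>
    rw [extendLast_castSucc, snocDir, snocDir, Fin.snoc_castSucc, Fin.snoc_castSucc,
      blockSum_castAdd]

theorem consDir_extendFirst {n n' m m' : ℕ} (σ : Fin n ≃ Fin n') (τ : Fin m ≃ Fin m')
    (c : Fin (n' + m') → Dir) (b : Dir) (i : Fin (m + 1)) :
    consDir c b (extendFirst τ i) = consDir (fun j => c (blockSum σ τ j)) b i := by
  induction i using Fin.cases with
  | zero => rw [extendFirst_zero, consDir, consDir, Fin.cons_zero, Fin.cons_zero]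
  | succ i =>
    rw [extendFirst_succ, consDir, consDir, Fin.cons_succ, Fin.cons_succ, blockSum_natAdd]

theorem snocDir_rotate {n m : ℕ} (c : Fin (m + n) → Dir) (b : Dir) (i : Fin (m + 1)) :
    snocDir c b ((finRotate (m + 1)).symm i) =
      consDir (fun j : Fin (n + m) => c (finAddFlip j)) b i := by
  induction i using Fin.cases with
  | zero => rw [finRotate_symm_zero, snocDir, consDir, Fin.snoc_last, Fin.cons_zero]
  | succ i =>
    rw [finRotate_symm_succ, snocDir, consDir, Fin.snoc_castSucc, Fin.cons_succ,
      finAddFlip_apply_natAdd]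

theorem consDir_rotate {n m : ℕ} (c : Fin (m + n) → Dir) (b : Dir) (i : Fin (n + 1)) :
    consDir c b (finRotate (n + 1) i) =
      snocDir (fun j : Fin (n + m) => c (finAddFlip j)) b i := by
  induction i using Fin.lastCases with
  | last => rw [finRotate_last, snocDir, consDir, Fin.snoc_last, Fin.cons_zero]
  | cast i =>
    rw [finRotate_castSucc, snocDir, consDir, Fin.snoc_castSucc, Fin.cons_succ,
      finAddFlip_apply_castAdd]

theorem sum_dir {M : Type*} [AddCommMonoid M] (F : Dir → M) :
    ∑ b, F b = F Dir.input + F Dir.output := by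
  rw [show (Finset.univ : Finset Dir) = {Dir.input, Dir.output} from rfl,
    Finset.sum_pair (by decide)]

theorem snocDir_val {n m : ℕ} (c : Fin (n + m) → Dir) (b : Dir) (i : Fin (n + 1)) :
    snocDir c b i = if h : i.val < n then c ⟨i.val, by omega⟩ else b := by
  induction i using Fin.lastCases with
  | last => rw [snocDir, Fin.snoc_last, dif_neg (by simp)]
  | cast i => rw [snocDir, Fin.snoc_castSucc, dif_pos (by simp)]; rfl

theorem consDir_val {n m : ℕ} (c : Fin (n + m) → Dir) (b : Dir) (i : Fin (m + 1)) :
    consDir c b i = if h : i.val = 0 then b else c ⟨n + (i.val - 1), by omega⟩ := by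
  induction i using Fin.cases with
  | zero => rw [consDir, Fin.cons_zero, dif_pos (by simp)]
  | succ i => rw [consDir, Fin.cons_succ, dif_neg (by simp)]; rfl

theorem compFam_assoc (P : Dioperad k) {n m l : ℕ} (f : ∀ c, P.obj (n + 1) c)
    (g : ∀ c, P.obj (m + 1 + 1) c) (h : ∀ c, P.obj (l + 1) c) :
    mapFam P (finCongr (Nat.add_assoc n m l))
        (compFam P (n + m) l (compFam P n (m + 1) f g) h) =
      compFam P n (m + l) f (mapFam P (finCongr (by omega)) (compFam P (m + 1) l g h)) := by
  ext c
  rw [mapFam_apply, compFam_apply, compFam_apply, map_sum]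
  have hL : ∀ b, P.comp (composable (fun i => c (finCongr (Nat.add_assoc n m l) i)) b)
      (compFam P n (m + 1) f g (snocDir (fun i => c (finCongr (Nat.add_assoc n m l) i)) b))
      (h (consDir (fun i => c (finCongr (Nat.add_assoc n m l) i)) b.flip)) = ∑ b' : Dir,
      P.comp (composable (fun i => c (finCongr (Nat.add_assoc n m l) i)) b)
      (P.comp (composable (n := n) (m := m + 1)
          (snocDir (fun i => c (finCongr (Nat.add_assoc n m l) i)) b) b')
        (f (snocDir (n := n) (m := m + 1)
          (snocDir (fun i => c (finCongr (Nat.add_assoc n m l) i)) b) b'))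
        (g (consDir (n := n) (m := m + 1)
          (snocDir (fun i => c (finCongr (Nat.add_assoc n m l) i)) b) b'.flip)))
      (h (consDir (fun i => c (finCongr (Nat.add_assoc n m l) i)) b.flip)) := by
    intro b
    rw [compFam_apply, map_sum, LinearMap.sum_apply]
  have hR : ∀ b' : Dir, P.comp (composable c b') (f (snocDir c b'))
      (mapFam P (finCongr (by omega)) (compFam P (m + 1) l g h) (consDir c b'.flip)) =
      ∑ b : Dir, P.comp (composable c b') (f (snocDir c b'))
      (P.map (finCongr (by omega)) (fun _ => rfl)
        (P.comp (composable (n := m + 1) (m := l)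
          (fun i => consDir c b'.flip (finCongr (by omega) i)) b)
        (g (snocDir (n := m + 1) (m := l)
          (fun i => consDir c b'.flip (finCongr (by omega) i)) b))
        (h (consDir (n := m + 1) (m := l)
          (fun i => consDir c b'.flip (finCongr (by omega) i)) b.flip)))) := by
    intro b'
    rw [mapFam_apply, compFam_apply, map_sum, map_sum]
  refine Eq.trans (Finset.sum_congr rfl fun b _ => (congrArg _ (hL b)).trans (map_sum _ _ _)) ?_
  refine Eq.trans ?_ (Finset.sum_congr rfl fun b' _ => (hR b').symm)
  rw [Finset.sum_comm]
  refine Finset.sum_congr rfl fun b' _ => Finset.sum_congr rfl fun b _ => ?_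
  have e1 : snocDir (n := n) (m := m + 1)
      (snocDir (fun i => c (finCongr (Nat.add_assoc n m l) i)) b) b' = snocDir c b' := by
    ext1 i
    have hi := i.isLt
    rw [snocDir_val, snocDir_val]
    split_ifs with h1
    · rw [snocDir_val (n := n + m) (m := l), dif_pos (show i.val < n + m by omega)]
      rfl
    · rfl
  have e2 : consDir (n := n) (m := m + 1)
      (snocDir (fun i => c (finCongr (Nat.add_assoc n m l) i)) b) b'.flip =
      snocDir (n := m + 1) (m := l)
          (fun i => consDir c b'.flip (finCongr (by omega) i)) b := by
    ext1 i
    have hi := i.isLt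
    rw [snocDir_val, consDir_val]
    split_ifs with h1 h2 h2
    · rw [consDir_val, dif_pos (by simpa using h1)]
    · omega
    · rw [snocDir_val (n := n + m) (m := l),
        dif_pos (show n + (i.val - 1) < n + m by omega), consDir_val, dif_neg (by simpa using h1)]
      rfl
    · rw [snocDir_val (n := n + m) (m := l),
        dif_neg (show ¬ n + (i.val - 1) < n + m by omega)]
  have e3 : consDir (fun i => c (finCongr (Nat.add_assoc n m l) i)) b.flip =
      consDir (n := m + 1) (m := l)
          (fun i => consDir c b'.flip (finCongr (by omega) i)) b.flip := by
    ext1 i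
    have hi := i.isLt
    rw [consDir_val, consDir_val]
    split_ifs with h1
    · rfl
    · rw [consDir_val, dif_neg (by simp)]
      refine congrArg c (Fin.ext ?_)
      simp only [finCongr_apply_coe]
      omega
  have hab : Composable (m := m + 1) (snocDir c b') (snocDir (n := m + 1) (m := l)
      (fun i => consDir c b'.flip (finCongr (by omega) i)) b)
      (snocDir (fun i => c (finCongr (Nat.add_assoc n m l) i)) b) := by
    rw [← e1, ← e2]
    exact composable _ _
  have habc : Composable (snocDir (fun i => c (finCongr (Nat.add_assoc n m l) i)) b)
      (consDir (n := m + 1) (m := l)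
        (fun i => consDir c b'.flip (finCongr (by omega) i)) b.flip)
      (fun i => c (finCongr (Nat.add_assoc n m l) i)) := by
    rw [← e3]
    exact composable _ _
  rw [← P.comp_assoc hab habc (composable _ _) (fun _ => rfl) (composable c b') (fun _ => rfl),
    comp_eq P f g _ hab e1 e2]
  congr 1
  exact congr_arg_comp P h _ _ habc e3

end LShriek

namespace LShriek

variable {k : Type u} [Field k]

theorem compFam_map (P : Dioperad k) {n m n' m' : ℕ} (σ : Fin n ≃ Fin n') (τ : Fin m ≃ Fin m')
    (f : ∀ c, P.obj (n + 1) c) (g : ∀ c, P.obj (m + 1) c) :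
    compFam P n' m' (mapFam P (extendLast σ) f) (mapFam P (extendFirst τ) g) =
      mapFam P (blockSum σ τ) (compFam P n m f g) := by
  ext c
  rw [mapFam_apply, compFam_apply, compFam_apply, map_sum]
  refine Finset.sum_congr rfl fun b _ => ?_
  rw [mapFam_eq P (extendLast σ) f (snocDir_extendLast σ τ c b),
    mapFam_eq P (extendFirst τ) g (consDir_extendFirst σ τ c b.flip)]
  exact P.comp_map σ τ _ _ _ _ _ _ _

theorem compFam_comm (P : Dioperad k) {n m : ℕ} {p q : ℤ}
    {f : ∀ c, P.obj (n + 1) c} {g : ∀ c, P.obj (m + 1) c}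
    (hf : ∀ c, f c ∈ (P.obj (n + 1) c).gr p) (hg : ∀ c, g c ∈ (P.obj (m + 1) c).gr q) :
    compFam P m n (mapFam P (finRotate (m + 1)).symm g) (mapFam P (finRotate (n + 1)) f) =
      (-1 : k) ^ (p * q) • mapFam P finAddFlip (compFam P n m f g) := by
  ext c
  rw [Pi.smul_apply, mapFam_apply, compFam_apply, compFam_apply, map_sum, Finset.smul_sum,
    sum_dir, sum_dir]
  refine (add_comm _ _).trans ?_
  congr 1
  · rw [mapFam_eq P _ g (snocDir_rotate c Dir.output),
      mapFam_eq P _ f (consDir_rotate c Dir.output.flip)]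
    exact P.comp_comm _ _ _ (composable _ Dir.input) _ (hf _) (hg _)
  · rw [mapFam_eq P _ g (snocDir_rotate c Dir.input),
      mapFam_eq P _ f (consDir_rotate c Dir.input.flip)]
    exact P.comp_comm _ _ _ (composable _ Dir.output) _ (hf _) (hg _)

theorem compFam_d (P : Dioperad k) {n m : ℕ} {p : ℤ} {f : ∀ c, P.obj (n + 1) c}
    (g : ∀ c, P.obj (m + 1) c) (hf : ∀ c, f c ∈ (P.obj (n + 1) c).gr p) :
    (fun c => (P.obj (n + m) c).d (compFam P n m f g c)) =
      compFam P n m (fun c => (P.obj (n + 1) c).d (f c)) g +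
        (-1 : k) ^ p • compFam P n m f (fun c => (P.obj (m + 1) c).d (g c)) := by
  ext c
  rw [Pi.add_apply, Pi.smul_apply, compFam_apply, compFam_apply, compFam_apply, map_sum,
    Finset.smul_sum, ← Finset.sum_add_distrib]
  exact Finset.sum_congr rfl fun b _ => P.comp_d _ _ (hf _)

theorem compFam_mem (P : Dioperad k) {n m : ℕ} {p q : ℤ} {f : ∀ c, P.obj (n + 1) c}
    {g : ∀ c, P.obj (m + 1) c} (hf : ∀ c, f c ∈ (P.obj (n + 1) c).gr p)
    (hg : ∀ c, g c ∈ (P.obj (m + 1) c).gr q) (c : Fin (n + m) → Dir) :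
    compFam P n m f g c ∈ (P.obj (n + m) c).gr (p + q) := by
  rw [compFam_apply]
  exact Submodule.sum_mem _ fun _ _ => P.comp_mem _ (hf _) (hg _)

theorem compFam_app {P Q : Dioperad k} (φ : P ⟶ Q) {n m : ℕ} (f : ∀ c, P.obj (n + 1) c)
    (g : ∀ c, P.obj (m + 1) c) :
    (fun c => φ.app (n + m) c (compFam P n m f g c)) =
      compFam Q n m (fun c => φ.app _ c (f c)) (fun c => φ.app _ c (g c)) := by
  ext c
  rw [compFam_apply, compFam_apply, map_sum]
  exact Finset.sum_congr rfl fun b _ => φ.app_comp _ _ _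

/-- The cyclic operad `L^!(P)`.  An operation with flags `0, …, n - 1` is a family (equivalently, a
formal sum) of operations of `P`, one for every choice of directions of the `n` flags: this is
`⨁ (r + s = n), P(r, s) ⊗ k[S n]` with coinvariants under `S r × S s` taken, the left Kan extension
along the functor from corollas with directed flags to corollas that forgets the directions.  A
composition along an edge vanishes on the summands for which the two flags have the same direction
and is the composition of `P` on the others. -/
noncomputable def obj (P : Dioperad k) : CyclicOperad k where
  obj n _ := DGVect.pi fun c : Fin n → Dir => P.obj n c
  map σ _ _ _ := mapFam P σ
  map_mem σ _ _ _ _ _ hx _ _ := P.map_mem σ _ (hx _ trivial)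
  map_d σ _ _ _ _ := funext fun _ => P.map_d σ _ _
  map_refl _ _ := funext fun _ => P.map_refl _ _
  map_trans σ τ _ _ _ _ _ _ _ := funext fun _ => P.map_trans σ τ _ _ _ _
  comp {n m} _ _ _ _ := compFam P n m
  comp_mem _ _ _ _ _ hx hy c _ :=
    compFam_mem P (fun c => hx c trivial) (fun c => hy c trivial) c
  comp_d _ _ _ y hx := compFam_d P y fun c => hx c trivial
  comp_map σ τ _ _ _ _ _ _ _ _ _ _ _ x y := compFam_map P σ τ x y
  comp_comm _ _ _ _ _ _ _ _ _ hx hy :=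
    compFam_comm P (fun c => hx c trivial) (fun c => hy c trivial)
  comp_assoc _ _ _ _ _ _ x y z := compFam_assoc P x y z

/-- The morphism of cyclic operads induced by a morphism of dioperads. -/
noncomputable def map {P Q : Dioperad k} (φ : P ⟶ Q) : obj P ⟶ obj Q where
  app n _ := LinearMap.pi fun c => φ.app n c ∘ₗ LinearMap.proj c
  app_mem n _ _ _ hx c _ := φ.app_mem n c (hx c trivial)
  app_d n _ x := funext fun c => φ.app_d n c (x c)
  app_map σ _ _ _ _ := funext fun _ => φ.app_map σ _ _
  app_comp _ x y := compFam_app φ x y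

end LShriek

/-- The functor `L^!` from dioperads to cyclic operads, for the map of Feynman categories that
forgets the directions of the flags. -/
noncomputable def LShriek (k : Type u) [Field k] : Dioperad k ⥤ CyclicOperad k where
  obj := LShriek.obj
  map := LShriek.map
  map_id _ := rfl
  map_comp _ _ := rfl

/-- The algebra structures on `A` over a dioperad `P`: the morphisms `P ⟶ EndDi A`. -/
abbrev DioperadAlgebra {k : Type u} [Field k] (P : Dioperad k) (A : DGVect.{u} k) :=
  P ⟶ EndDi A

/-- The algebra structures on `(V, B)` over a cyclic operad `O`: the morphisms `O ⟶ EndCyc V B`. -/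
abbrev CyclicAlgebra {k : Type u} [Field k] (O : CyclicOperad k) (V : DGVect.{u} k)
    (B : SymmetricForm V) :=
  O ⟶ EndCyc V B

/-! The isomorphism `e` is the distributivity of the tensor product over direct sums. Expanding
every factor of `(A ⊕ A*)^{⊗n}` gives one summand for each choice, at every flag, of `A` (an output)
or `A*` (an input), and this summand is the space of operations of `EndDi A` with these directions.
The bijections and the differentials match, because the projections of `A ⊕ A*` to its two summands
are chain maps of degree `0` and Koszul signs depend on degrees only. The compositions match because
the hyperbolic form vanishes on `A ⊗ A` and on `A* ⊗ A*` and is the evaluation, with its Koszul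
sign, on the mixed parts: contraction with it is the sum of the contractions over the two directions
of the edge, which is the composition of `L^!`. This is `doubleProj_compT`, the main computation.

For the left adjoint, operations of `R^!(O)` are formal expressions built from elements of `O` with
chosen directions and from symbols for the structure of a dioperad. Two expressions are identified
when they have equal values in every dioperad `P` under every `O ⟶ L^!(P)`. By this choice the
values are jointly injective on classes, so every axiom of a dioperad, and every relation saying
that `O` maps to `L^!(R^!(O))`, holds in the quotient because it holds in each `P`. What needs an
argument of its own is that the homogeneous classes span, by induction on expressions
(`mk_mem_iSup_grading`). Evaluation gives the existence half of the universal property; uniqueness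
is `app_mk`, since classes of expressions exhaust `R^!(O)` and a morphism commutes with every
symbol.

For an arbitrary left adjoint `R`, the required bijection is then the one of the adjunction followed
by composition with `e`. -/

/-! ### Isomorphisms of operads -/

namespace FlagOperad

variable {k : Type u} [Field k] {C : Type} [FlagColour C]

/-- A morphism of operads with a componentwise inverse of degree `0` is an isomorphism. -/
def isoOfInverse {P Q : FlagOperad k C} (f : P ⟶ Q)
    (g : (n : ℕ) → (c : Fin n → C) → (Q.obj n c →ₗ[k] P.obj n c))
    (g_mem : ∀ (n : ℕ) (c : Fin n → C) {p : ℤ} {x : Q.obj n c}, x ∈ (Q.obj n c).gr p →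
      g n c x ∈ (P.obj n c).gr p)
    (hfg : ∀ n c x, f.app n c (g n c x) = x) (hgf : ∀ n c x, g n c (f.app n c x) = x) :
    P ≅ Q where
  hom := f
  inv :=
    { app := g
      app_mem := g_mem
      app_d := fun n c x => by
        -- An inverse of a map that commutes with an operation commutes with it too: write each
        -- argument as `f` of its preimage, pull the operation through `f` and cancel. The rewriting
        -- is confined to the left side because the arguments also occur on the right. The degree
        -- condition is a membership and not an equation, so it is supplied separately as `g_mem`.
        conv_lhs => rw [← hfg n c x, ← f.app_d, hgf]
      app_map := fun {n m} σ {c c'} h x => by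
        conv_lhs => rw [← hfg n c x, ← f.app_map, hgf]
      app_comp := fun {n m} {a b c} h x y => by
        conv_lhs => rw [← hfg _ a x, ← hfg _ b y, ← f.app_comp, hgf] }
  hom_inv_id := Hom.ext (funext fun n => funext fun c => LinearMap.ext (hgf n c))
  inv_hom_id := Hom.ext (funext fun n => funext fun c => LinearMap.ext (hfg n c))

end FlagOperad

/-! ### The two summands of the double and the hyperbolic form -/

namespace DGVect

variable {k : Type u} [Field k] (A : DGVect.{u} k)

/-- The inclusion of `A` or `A*` in the double. -/
noncomputable def flagIncl : (b : Dir) → A.flag b →ₗ[k] A.double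
  | .input => LinearMap.inr k A A.dual
  | .output => LinearMap.inl k A A.dual

/-- The projection of the double to `A` or `A*`. -/
noncomputable def flagProj : (b : Dir) → A.double →ₗ[k] A.flag b
  | .input => LinearMap.snd k A A.dual
  | .output => LinearMap.fst k A A.dual

theorem flagIncl_mem (b : Dir) {p : ℤ} {x : A.flag b} (hx : x ∈ (A.flag b).gr p) :
    A.flagIncl b x ∈ A.double.gr p := by
  cases b
  · exact ⟨Submodule.zero_mem _, hx⟩
  · exact ⟨hx, Submodule.zero_mem _⟩

theorem flagProj_mem (b : Dir) {p : ℤ} {x : A.double} (hx : x ∈ A.double.gr p) :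
    A.flagProj b x ∈ (A.flag b).gr p := by
  cases b
  · exact hx.2
  · exact hx.1

theorem flagProj_d (b : Dir) (x : A.double) :
    A.flagProj b (A.double.d x) = (A.flag b).d (A.flagProj b x) := by
  cases b <;> rfl

theorem flagProj_flagIncl (b : Dir) (x : A.flag b) : A.flagProj b (A.flagIncl b x) = x := by
  cases b <;> rfl

theorem flagProj_flagIncl_of_ne {b b' : Dir} (h : b ≠ b') (x : A.flag b') :
    A.flagProj b (A.flagIncl b' x) = 0 := by
  cases b <;> cases b' <;> first | exact absurd rfl h | rfl

/-- Together with `flagProj_flagIncl` and `flagProj_flagIncl_of_ne` this is a complete system of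
orthogonal projections of `A ⊕ A*`. Its tensor powers give the inverse of the decomposition below.
-/
theorem sum_flagIncl_flagProj (x : A.double) : ∑ b, A.flagIncl b (A.flagProj b x) = x := by
  rw [LShriek.sum_dir]
  exact Prod.ext (zero_add x.1) (add_zero x.2)

/-- Permuting and joining families of vectors introduces transports between directions that are only
provably equal. The projections start from one space for all directions, so they absorb these
transports. -/
theorem castV_flagProj {b b' : Dir} (h : b = b') (x : A.double) :
    TensorEnd.castV A.flag h (A.flagProj b x) = A.flagProj b' x := by
  subst h; rfl

/-- Only pairs of opposite directions contribute: `input` gives the evaluation of the functional in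
`x`, and `output` gives the evaluation of the functional in `y` with its Koszul sign. This is why
contraction with the form becomes a sum over the directions of an edge. -/
theorem hyperbolicForm_eq_sum (x y : A.double) :
    A.hyperbolicForm.form x y =
      ∑ b : Dir, A.flagPairing.pair b b.flip (A.flagProj b x) (A.flagProj b.flip y) := by
  rw [LShriek.sum_dir]
  rfl

/-- In a composition the directions at the glued flags appear as `snocDir c b (Fin.last n)` and
`consDir c b.flip 0`, which have to be replaced by `b` and `b.flip` inside dependent types. -/
theorem flagPairing_flagProj_congr {b b' e e' : Dir} (h : b = e) (h' : b' = e') (x y : A.double) :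
    A.flagPairing.pair b b' (A.flagProj b x) (A.flagProj b' y) =
      A.flagPairing.pair e e' (A.flagProj e x) (A.flagProj e' y) := by
  subst h; subst h'; rfl

/-! ### Decomposition of tensors by the directions of their factors -/

open TensorEnd

/-- The component of a tensor of vectors of the double at the directions `c` of the factors. -/
noncomputable def doubleProj {n : ℕ} (u : Fin n → Unit) (c : Fin n → Dir) :
    T (fun _ : Unit => A.double) u →ₗ[k] T A.flag c :=
  PiTensorProduct.map fun i => A.flagProj (c i)

/-- The inclusion of the tensors whose factors have the directions `c`. -/
noncomputable def doubleIncl {n : ℕ} (u : Fin n → Unit) (c : Fin n → Dir) :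
    T A.flag c →ₗ[k] T (fun _ : Unit => A.double) u :=
  PiTensorProduct.map fun i => A.flagIncl (c i)

theorem doubleProj_tprod {n : ℕ} (u : Fin n → Unit) (c : Fin n → Dir) (v : Fin n → A.double) :
    A.doubleProj u c (PiTensorProduct.tprod k v) =
      PiTensorProduct.tprod k fun i => A.flagProj (c i) (v i) :=
  PiTensorProduct.map_tprod _ _

theorem doubleIncl_tprod {n : ℕ} (u : Fin n → Unit) (c : Fin n → Dir) (v : ∀ i, A.flag (c i)) :
    A.doubleIncl u c (PiTensorProduct.tprod k v) =
      PiTensorProduct.tprod k fun i => A.flagIncl (c i) (v i) :=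
  PiTensorProduct.map_tprod _ _

/-- The family of degrees `p` is the same before and after projection. All Koszul signs are
functions of `p`, so they agree on both sides of the comparisons that follow. -/
theorem homog_flagProj {n : ℕ} {u : Fin n → Unit} (c : Fin n → Dir) {p : Fin n → ℤ}
    {v : Fin n → A.double} (hv : Homog (fun _ : Unit => A.double) u p v) :
    Homog A.flag c p fun i => A.flagProj (c i) (v i) :=
  fun i => A.flagProj_mem (c i) (hv i)

theorem doubleProj_mem {n : ℕ} (u : Fin n → Unit) (c : Fin n → Dir) {q : ℤ}
    {x : T (fun _ : Unit => A.double) u} (hx : x ∈ tgr (fun _ : Unit => A.double) u q) :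
    A.doubleProj u c x ∈ tgr A.flag c q := by
  refine mem_of_mem (f := A.doubleProj u c) (fun p v hv hq => ?_) hx
  rw [doubleProj_tprod]
  exact tprod_mem (A.homog_flagProj c hv) hq

theorem doubleIncl_mem {n : ℕ} (u : Fin n → Unit) (c : Fin n → Dir) {q : ℤ}
    {x : T A.flag c} (hx : x ∈ tgr A.flag c q) :
    A.doubleIncl u c x ∈ tgr (fun _ : Unit => A.double) u q := by
  refine mem_of_mem (f := A.doubleIncl u c) (fun p v hv hq => ?_) hx
  rw [doubleIncl_tprod]
  exact tprod_mem (V := fun _ : Unit => A.double) (fun i => A.flagIncl_mem (c i) (hv i)) hq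

/-- The Leibniz terms carry equal signs on both sides, and in the differentiated factor the
projection commutes with `d`. -/
theorem doubleProj_td {n : ℕ} (u : Fin n → Unit) (c : Fin n → Dir)
    (x : T (fun _ : Unit => A.double) u) :
    A.doubleProj u c (td (fun _ : Unit => A.double) u x) = td A.flag c (A.doubleProj u c x) := by
  refine LinearMap.congr_fun (f := A.doubleProj u c ∘ₗ td (fun _ : Unit => A.double) u)
    (g := td A.flag c ∘ₗ A.doubleProj u c) (TensorEnd.hom_ext fun p v hv => ?_) x
  rw [LinearMap.comp_apply, LinearMap.comp_apply, td_tprod hv, doubleProj_tprod,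
    td_tprod (A.homog_flagProj c hv), map_sum]
  refine Finset.sum_congr rfl fun i _ => ?_
  rw [map_smul, doubleProj_tprod]
  congr 2
  ext1 j
  by_cases hj : j = i
  · subst hj
    rw [Function.update_self, Function.update_self, flagProj_d]
  · rw [Function.update_of_ne hj, Function.update_of_ne hj]

theorem doubleProj_act {n m : ℕ} (σ : Fin n ≃ Fin m) {u : Fin n → Unit} {u' : Fin m → Unit}
    (hu : ∀ i, u' (σ i) = u i) {c : Fin n → Dir} {c' : Fin m → Dir} (h : ∀ i, c' (σ i) = c i)
    (x : T (fun _ : Unit => A.double) u) :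
    A.doubleProj u' c' (act (fun _ : Unit => A.double) σ hu x) =
      act A.flag σ h (A.doubleProj u c x) := by
  refine LinearMap.congr_fun (f := A.doubleProj u' c' ∘ₗ act (fun _ : Unit => A.double) σ hu)
    (g := act A.flag σ h ∘ₗ A.doubleProj u c) (TensorEnd.hom_ext fun p v hv => ?_) x
  rw [LinearMap.comp_apply, LinearMap.comp_apply, act_tprod σ hu hv, doubleProj_tprod,
    act_tprod σ h (A.homog_flagProj c hv), map_smul, doubleProj_tprod]
  congr 2
  refine family_ext σ fun i => ?_
  rw [permV_apply σ h, castV_flagProj]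
  -- The colours on the side of the double lie in `Unit`, so the transport in `permV_apply` is the
  -- identity by computation.
  exact congrArg _ (permV_apply (V := fun _ : Unit => A.double) σ hu v i)

/-- The pairings of the endomorphism operad of the double. -/
noncomputable def doublePairing : FlagPairing fun _ : Unit => A.double where
  pair _ _ := A.hyperbolicForm.form
  degree hx hy h := A.hyperbolicForm.degree hx hy h
  symm hx hy := A.hyperbolicForm.symm hx hy
  chain y hx := A.hyperbolicForm.chain y hx

/-- On pure tensors the composite is the form of the two glued vectors times the joined tensor. Its
component at `c` fixes the directions of the remaining flags only; `hyperbolicForm_eq_sum` splits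
the scalar according to the direction `b` of the glued flag of `x`. The summand of `b` is the
composite of the components at `snocDir c b` and `consDir c b.flip`, while the joined tensor does
not depend on `b`. -/
theorem doubleProj_compT {n m : ℕ} {u : Fin (n + 1) → Unit} {u' : Fin (m + 1) → Unit}
    {u'' : Fin (n + m) → Unit} (hu : Composable u u' u'') (c : Fin (n + m) → Dir)
    (x : T (fun _ : Unit => A.double) u) (y : T (fun _ : Unit => A.double) u') :
    A.doubleProj u'' c (compT A.doublePairing hu x y) =
      ∑ b : Dir, compT A.flagPairing (LShriek.composable c b)
        (A.doubleProj u (LShriek.snocDir c b) x) (A.doubleProj u' (LShriek.consDir c b.flip) y) := by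
  induction x using PiTensorProduct.induction_on with
  | add x x' hx hx' => simp only [map_add, LinearMap.add_apply, hx, hx', Finset.sum_add_distrib]
  | smul_tprod r v =>
  induction y using PiTensorProduct.induction_on with
  | add x x' hx hx' => simp only [map_add, hx, hx', Finset.sum_add_distrib]
  | smul_tprod s w =>
  simp only [map_smul, LinearMap.smul_apply, ← Finset.smul_sum]
  congr 2
  rw [compT_tprod, map_smul, doubleProj_tprod, doublePairing]
  dsimp only
  rw [hyperbolicForm_eq_sum, Finset.sum_smul]
  refine Finset.sum_congr rfl fun b _ => ?_
  rw [doubleProj_tprod, doubleProj_tprod, compT_tprod]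
  congr 1
  -- The scalars: the last flag of the first corolla has direction `b` and the first flag of the
  -- second one has direction `b.flip`.
  · refine A.flagPairing_flagProj_congr ?_ ?_ _ _
    · rw [LShriek.snocDir, Fin.snoc_last]
    · rw [LShriek.consDir, Fin.cons_zero]
  · congr 1
    -- The joined families: at each remaining flag both sides are the projection, in the direction
    -- prescribed by `c`, of the same vector of `v` or `w`, up to a transport.
    refine sum_family_ext (fun i => ?_) fun j => ?_
    · refine Eq.trans ?_ ((join_left ..).trans (A.castV_flagProj _ _)).symm
      exact congrArg _ (join_left (V := fun _ : Unit => A.double) hu.left hu.right v w i)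
    · refine Eq.trans ?_ ((join_right ..).trans (A.castV_flagProj _ _)).symm
      exact congrArg _ (join_right (V := fun _ : Unit => A.double) hu.left hu.right v w j)

theorem doubleProj_doubleIncl {n : ℕ} (u : Fin n → Unit) (c : Fin n → Dir) (x : T A.flag c) :
    A.doubleProj u c (A.doubleIncl u c x) = x := by
  refine LinearMap.congr_fun (f := A.doubleProj u c ∘ₗ A.doubleIncl u c) (g := LinearMap.id)
    (TensorEnd.hom_ext fun p v _ => ?_) x
  rw [LinearMap.comp_apply, doubleIncl_tprod, doubleProj_tprod, LinearMap.id_apply]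
  simp only [flagProj_flagIncl]

/-- Different choices of directions differ at some flag, where including and then projecting is
zero; one zero factor annihilates a pure tensor. -/
theorem doubleProj_doubleIncl_of_ne {n : ℕ} (u : Fin n → Unit) {c c' : Fin n → Dir} (h : c ≠ c')
    (x : T A.flag c') : A.doubleProj u c (A.doubleIncl u c' x) = 0 := by
  refine LinearMap.congr_fun (f := A.doubleProj u c ∘ₗ A.doubleIncl u c') (g := 0)
    (TensorEnd.hom_ext fun p v _ => ?_) x
  obtain ⟨i, hi⟩ := Function.ne_iff.1 h
  rw [LinearMap.comp_apply, doubleIncl_tprod, doubleProj_tprod, LinearMap.zero_apply]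
  exact MultilinearMap.map_coord_zero _ i (A.flagProj_flagIncl_of_ne hi _)

/-- Multilinear expansion: writing every vector as the sum of its two components and multiplying out
gives one pure tensor for each function `c : Fin n → Dir`. -/
theorem sum_doubleIncl_doubleProj {n : ℕ} (u : Fin n → Unit)
    (x : T (fun _ : Unit => A.double) u) :
    ∑ c, A.doubleIncl u c (A.doubleProj u c x) = x := by
  have : ∑ c, A.doubleIncl u c ∘ₗ A.doubleProj u c = LinearMap.id := by
    refine TensorEnd.hom_ext fun p v _ => ?_
    simp only [LinearMap.sum_apply, LinearMap.comp_apply, doubleProj_tprod, doubleIncl_tprod,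
      LinearMap.id_apply]
    refine ((PiTensorProduct.tprod k).map_sum fun i b => A.flagIncl b (A.flagProj b (v i))).symm.trans
      ?_
    simp only [sum_flagIncl_flagProj]
  exact (LinearMap.sum_apply _ _ _).symm.trans (LinearMap.congr_fun this x)

/-- The decomposition of the tensor powers of the double by the directions of the factors, as a
morphism of cyclic operads. -/
noncomputable def doubleDecomp :
    EndCyc A.double A.hyperbolicForm ⟶ (LShriek k).obj (EndDi A) where
  app _ u := LinearMap.pi fun c => A.doubleProj u c
  app_mem _ u _ _ hx c _ := A.doubleProj_mem u c hx
  app_d _ u x := funext fun c => A.doubleProj_td u c x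
  app_map σ _ _ hu x := funext fun _ => A.doubleProj_act σ hu (fun _ => rfl) x
  app_comp hu x y := funext fun c => A.doubleProj_compT hu c x y

/-- The isomorphism of `L^!` of the endomorphism dioperad with the endomorphism cyclic operad of
the double. -/
noncomputable def lShriekEndDiIso :
    (LShriek k).obj (EndDi A) ≅ EndCyc A.double A.hyperbolicForm :=
  -- Compatibility with the operad structure is proved for the projections, since equalities in the
  -- target can be tested on the component at each `c`. The inverse, a sum of inclusions, inherits
  -- it; `symm` then gives the direction required of `e`.
  (FlagOperad.isoOfInverse A.doubleDecomp
    (fun n u => ∑ c : Fin n → Dir, A.doubleIncl u c ∘ₗ LinearMap.proj c)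
    (fun n u _ x hx => by
      rw [LinearMap.sum_apply]
      exact Submodule.sum_mem _ fun c _ => A.doubleIncl_mem u c (hx c trivial))
    (fun n u x => funext fun c => by
      rw [LinearMap.sum_apply]
      change A.doubleProj u c (∑ c', A.doubleIncl u c' (x c')) = x c
      -- By orthogonality only the summand with the directions `c` survives the projection to the
      -- component at `c`.
      rw [map_sum, Finset.sum_eq_single c]
      · exact A.doubleProj_doubleIncl u c (x c)
      · exact fun c' _ h => A.doubleProj_doubleIncl_of_ne u h.symm _
      · exact fun h => absurd (Finset.mem_univ c) h)
    (fun n u x => by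
      rw [LinearMap.sum_apply]
      exact A.sum_doubleIncl_doubleProj u x)).symm

end DGVect

/-! ### The left adjoint of `L^!` -/

namespace RShriek

variable {k : Type u} [Field k]

/-! ### Expressions and their identification -/

/-- Formal expressions in the operations of a cyclic operad `O` with chosen directions of their
flags, and in the structure operations of a dioperad. -/
inductive Term (O : CyclicOperad k) : (n : ℕ) → (Fin n → Dir) → Type u
  | gen {n : ℕ} (c : Fin n → Dir) (x : O.obj n fun _ => ()) : Term O n c
  | zero {n : ℕ} (c : Fin n → Dir) : Term O n c
  | add {n : ℕ} {c : Fin n → Dir} (s t : Term O n c) : Term O n c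
  | smul {n : ℕ} {c : Fin n → Dir} (r : k) (t : Term O n c) : Term O n c
  | d {n : ℕ} {c : Fin n → Dir} (t : Term O n c) : Term O n c
  | map {n m : ℕ} (σ : Fin n ≃ Fin m) {c : Fin n → Dir} {c' : Fin m → Dir}
      (h : ∀ i, c' (σ i) = c i) (t : Term O n c) : Term O m c'
  | comp {n m : ℕ} {a : Fin (n + 1) → Dir} {b : Fin (m + 1) → Dir} {c : Fin (n + m) → Dir}
      (h : Composable a b c) (s : Term O (n + 1) a) (t : Term O (m + 1) b) : Term O (n + m) c

/-- The value of an expression in a dioperad `P`, given a morphism from `O` to `L^!(P)`. -/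
noncomputable def Term.eval {O : CyclicOperad k} {P : Dioperad k} (φ : O ⟶ (LShriek k).obj P) :
    {n : ℕ} → {c : Fin n → Dir} → Term O n c → P.obj n c
  | _, _, .gen c x => (φ.app _ _ x : ∀ c, P.obj _ c) c
  | _, _, .zero _ => 0
  | _, _, .add s t => s.eval φ + t.eval φ
  | _, _, .smul r t => r • t.eval φ
  | _, _, .d t => (P.obj _ _).d (t.eval φ)
  | _, _, .map σ h t => P.map σ h (t.eval φ)
  | _, _, .comp h s t => P.comp h (s.eval φ) (t.eval φ)

/-- Two expressions are identified if they have the same value in every dioperad. -/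
def setoid (O : CyclicOperad k) (n : ℕ) (c : Fin n → Dir) : Setoid (Term O n c) where
  -- The quantifier over all dioperads only enters a proposition, so the quotient stays in the
  -- universe of the expressions. The relation replaces a list of generating relations: it consists
  -- of exactly those equations that every `O ⟶ L^!(P)` forces.
  r s t := ∀ (P : Dioperad k) (φ : O ⟶ (LShriek k).obj P), s.eval φ = t.eval φ
  iseqv := ⟨fun _ _ _ => rfl, fun h P φ => (h P φ).symm, fun h h' P φ => (h P φ).trans (h' P φ)⟩

/-- The underlying type of the operations of `R^!(O)`. -/
def Carrier (O : CyclicOperad k) (n : ℕ) (c : Fin n → Dir) : Type u := Quotient (setoid O n c)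

section

variable {O : CyclicOperad k}

/-- The class of an expression. -/
def mk {n : ℕ} {c : Fin n → Dir} (t : Term O n c) : Carrier O n c := Quotient.mk _ t

/-- The value of a class in a dioperad. -/
noncomputable def value {P : Dioperad k} (φ : O ⟶ (LShriek k).obj P) {n : ℕ} {c : Fin n → Dir} :
    Carrier O n c → P.obj n c :=
  Quotient.lift (Term.eval φ) fun _ _ h => h P φ

theorem mk_surjective {n : ℕ} {c : Fin n → Dir} (x : Carrier O n c) : ∃ t, mk t = x :=
  Quotient.exists_rep x

/-- The values are jointly injective by the choice of the identification. Hence an equation between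
classes may be checked in each `P`, where it is an axiom of dioperads or a property of `φ`. -/
theorem ext {n : ℕ} {c : Fin n → Dir} {x y : Carrier O n c}
    (h : ∀ (P : Dioperad k) (φ : O ⟶ (LShriek k).obj P), value φ x = value φ y) : x = y := by
  obtain ⟨s, rfl⟩ := mk_surjective x
  obtain ⟨t, rfl⟩ := mk_surjective y
  exact Quotient.sound h

/-! ### The vector space of classes -/

variable {n : ℕ} {c : Fin n → Dir}

noncomputable instance : Zero (Carrier O n c) := ⟨mk (.zero c)⟩

noncomputable instance : Add (Carrier O n c) :=
  ⟨Quotient.map₂ Term.add fun _ _ h _ _ h' P φ => congrArg₂ (· + ·) (h P φ) (h' P φ)⟩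

noncomputable instance : SMul k (Carrier O n c) :=
  ⟨fun r => Quotient.map (Term.smul r) fun _ _ h P φ => congrArg (r • ·) (h P φ)⟩

/-- Expressions have no symbol for negatives; the scalar `-1` takes its place, and `value_neg` shows
that values see the usual negative. -/
noncomputable instance : Neg (Carrier O n c) := ⟨fun x => (-1 : k) • x⟩

theorem value_zero {P : Dioperad k} (φ : O ⟶ (LShriek k).obj P) :
    value φ (0 : Carrier O n c) = 0 := rfl

theorem value_add {P : Dioperad k} (φ : O ⟶ (LShriek k).obj P) (x y : Carrier O n c) :
    value φ (x + y) = value φ x + value φ y := by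
  obtain ⟨s, rfl⟩ := mk_surjective x
  obtain ⟨t, rfl⟩ := mk_surjective y
  rfl

theorem value_smul {P : Dioperad k} (φ : O ⟶ (LShriek k).obj P) (r : k) (x : Carrier O n c) :
    value φ (r • x) = r • value φ x := by
  obtain ⟨s, rfl⟩ := mk_surjective x
  rfl

theorem value_neg {P : Dioperad k} (φ : O ⟶ (LShriek k).obj P) (x : Carrier O n c) :
    value φ (-x) = - value φ x :=
  (value_smul φ (-1) x).trans (neg_one_smul k _)

noncomputable instance : AddCommGroup (Carrier O n c) where
  add_assoc x y z := ext fun P φ => by simp only [value_add, add_assoc]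
  zero_add x := ext fun P φ => by rw [value_add, value_zero, zero_add]
  add_zero x := ext fun P φ => by rw [value_add, value_zero, add_zero]
  nsmul := nsmulRec
  zsmul := zsmulRec
  neg_add_cancel x := ext fun P φ => by rw [value_add, value_neg, value_zero, neg_add_cancel]
  add_comm x y := ext fun P φ => by rw [value_add, value_add, add_comm]

noncomputable instance : Module k (Carrier O n c) where
  one_smul x := ext fun P φ => by rw [value_smul, one_smul]
  mul_smul r s x := ext fun P φ => by simp only [value_smul, mul_smul]
  smul_zero r := ext fun P φ => by rw [value_smul, value_zero, smul_zero]
  smul_add r x y := ext fun P φ => by simp only [value_smul, value_add, smul_add]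
  add_smul r s x := ext fun P φ => by simp only [value_smul, value_add, add_smul]
  zero_smul x := ext fun P φ => by rw [value_smul, value_zero, zero_smul]

/-- The value of an operation in a dioperad, as a linear map. -/
noncomputable def valueₗ {P : Dioperad k} (φ : O ⟶ (LShriek k).obj P) (n : ℕ) (c : Fin n → Dir) :
    Carrier O n c →ₗ[k] P.obj n c where
  toFun := value φ
  map_add' := value_add φ
  map_smul' := value_smul φ

/-- Joint injectivity in terms of linear maps, so that `map_add`, `map_smul` and `map_sum` apply to
the resulting goals. -/
theorem ext_valueₗ {x y : Carrier O n c}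
    (h : ∀ (P : Dioperad k) (φ : O ⟶ (LShriek k).obj P), valueₗ φ n c x = valueₗ φ n c y) :
    x = y := ext h

/-! ### The structure operations on classes -/

/-- The differential of the operations of `R^!(O)`. -/
noncomputable def dₗ (O : CyclicOperad k) (n : ℕ) (c : Fin n → Dir) :
    Carrier O n c →ₗ[k] Carrier O n c where
  toFun := Quotient.map Term.d fun _ _ h P φ => congrArg (P.obj n c).d (h P φ)
  map_add' x y := ext fun P φ => by
    obtain ⟨s, rfl⟩ := mk_surjective x
    obtain ⟨t, rfl⟩ := mk_surjective y
    exact map_add (P.obj n c).d _ _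
  map_smul' r x := ext fun P φ => by
    obtain ⟨s, rfl⟩ := mk_surjective x
    exact map_smul (P.obj n c).d _ _

/-- Evaluation is defined by recursion on expressions, so it commutes with each symbol by
definition. This lemma, `valueₗ_mapₗ` and `valueₗ_compₗ` are used twice: they transfer the axioms
from `P` to `R^!(O)`, and they make evaluation a morphism of dioperads in `desc`. -/
theorem valueₗ_dₗ {P : Dioperad k} (φ : O ⟶ (LShriek k).obj P) (x : Carrier O n c) :
    valueₗ φ n c (dₗ O n c x) = (P.obj n c).d (valueₗ φ n c x) := by
  obtain ⟨s, rfl⟩ := mk_surjective x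
  rfl

/-- The action of bijections on the operations of `R^!(O)`. -/
noncomputable def mapₗ {n m : ℕ} (σ : Fin n ≃ Fin m) {c : Fin n → Dir} {c' : Fin m → Dir}
    (h : ∀ i, c' (σ i) = c i) : Carrier O n c →ₗ[k] Carrier O m c' where
  toFun := Quotient.map (Term.map σ h) fun _ _ e P φ => congrArg (P.map σ h) (e P φ)
  map_add' x y := ext fun P φ => by
    obtain ⟨s, rfl⟩ := mk_surjective x
    obtain ⟨t, rfl⟩ := mk_surjective y
    exact map_add (P.map σ h) _ _
  map_smul' r x := ext fun P φ => by
    obtain ⟨s, rfl⟩ := mk_surjective x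
    exact map_smul (P.map σ h) _ _

theorem valueₗ_mapₗ {P : Dioperad k} (φ : O ⟶ (LShriek k).obj P) {n m : ℕ} (σ : Fin n ≃ Fin m)
    {c : Fin n → Dir} {c' : Fin m → Dir} (h : ∀ i, c' (σ i) = c i) (x : Carrier O n c) :
    valueₗ φ m c' (mapₗ σ h x) = P.map σ h (valueₗ φ n c x) := by
  obtain ⟨s, rfl⟩ := mk_surjective x
  rfl

/-- The composition of the operations of `R^!(O)`. -/
noncomputable def compₗ {n m : ℕ} {a : Fin (n + 1) → Dir} {b : Fin (m + 1) → Dir}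
    {c : Fin (n + m) → Dir} (h : Composable a b c) :
    Carrier O (n + 1) a →ₗ[k] Carrier O (m + 1) b →ₗ[k] Carrier O (n + m) c :=
  LinearMap.mk₂ k
    (Quotient.map₂ (Term.comp h) fun _ _ e _ _ e' P φ =>
      congrArg₂ (fun x y => P.comp h x y) (e P φ) (e' P φ))
    (fun x x' y => ext fun P φ => by
      obtain ⟨s, rfl⟩ := mk_surjective x
      obtain ⟨s', rfl⟩ := mk_surjective x'
      obtain ⟨t, rfl⟩ := mk_surjective y
      exact LinearMap.map_add₂ (P.comp h) _ _ _)
    (fun r x y => ext fun P φ => by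
      obtain ⟨s, rfl⟩ := mk_surjective x
      obtain ⟨t, rfl⟩ := mk_surjective y
      exact LinearMap.map_smul₂ (P.comp h) _ _ _)
    (fun x y y' => ext fun P φ => by
      obtain ⟨s, rfl⟩ := mk_surjective x
      obtain ⟨t, rfl⟩ := mk_surjective y
      obtain ⟨t', rfl⟩ := mk_surjective y'
      exact map_add (P.comp h _) _ _)
    (fun r x y => ext fun P φ => by
      obtain ⟨s, rfl⟩ := mk_surjective x
      obtain ⟨t, rfl⟩ := mk_surjective y
      exact map_smul (P.comp h _) _ _)

theorem valueₗ_compₗ {P : Dioperad k} (φ : O ⟶ (LShriek k).obj P) {n m : ℕ}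
    {a : Fin (n + 1) → Dir} {b : Fin (m + 1) → Dir} {c : Fin (n + m) → Dir}
    (h : Composable a b c) (x : Carrier O (n + 1) a) (y : Carrier O (m + 1) b) :
    valueₗ φ _ c (compₗ h x y) = P.comp h (valueₗ φ _ a x) (valueₗ φ _ b y) := by
  obtain ⟨s, rfl⟩ := mk_surjective x
  obtain ⟨t, rfl⟩ := mk_surjective y
  rfl

/-- The operations given by those of `O` and a choice of directions. -/
noncomputable def genₗ {n : ℕ} (c : Fin n → Dir) :
    (O.obj n fun _ => ()) →ₗ[k] Carrier O n c where
  toFun x := mk (.gen c x)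
  map_add' x y := ext fun _ φ =>
    -- Additivity in the generator is not imposed on expressions; it holds in the quotient because
    -- each `φ` is linear.
    congrFun (map_add (φ.app n fun _ => ()) x y) c
  map_smul' r x := ext fun _ φ =>
    congrFun (map_smul (φ.app n fun _ => ()) r x) c

theorem valueₗ_genₗ {P : Dioperad k} (φ : O ⟶ (LShriek k).obj P) {n : ℕ} (c : Fin n → Dir)
    (x : O.obj n fun _ => ()) :
    valueₗ φ n c (genₗ c x) = (φ.app n _ x : ∀ c, P.obj n c) c := rfl

/-- Both sides have the same value in each `P` by associativity there. Indices such as `n + (m + 1)`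
and `n + m + 1` agree only by computation, so the value lemmas are applied with explicit indices and
chained instead of being used for rewriting. -/
theorem compₗ_assoc {n m l : ℕ} {a : Fin (n + 1) → Dir} {b : Fin (m + 1 + 1) → Dir}
    {c : Fin (l + 1) → Dir} {ab : Fin (n + m + 1) → Dir} {bc : Fin (m + 1 + l) → Dir}
    {bc' : Fin (m + l + 1) → Dir} {abc : Fin (n + m + l) → Dir} {abc' : Fin (n + (m + l)) → Dir}
    (hab : Composable (m := m + 1) a b ab) (habc : Composable ab c abc)
    (hbc : Composable (n := m + 1) b c bc)
    (hr : ∀ i, bc' (finCongr (by omega : m + 1 + l = m + l + 1) i) = bc i)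
    (habc' : Composable (m := m + l) a bc' abc')
    (hs : ∀ i, abc' (finCongr (Nat.add_assoc n m l) i) = abc i)
    (x : Carrier O (n + 1) a) (y : Carrier O (m + 1 + 1) b) (z : Carrier O (l + 1) c) :
    mapₗ (finCongr (Nat.add_assoc n m l)) hs (compₗ habc (compₗ (m := m + 1) hab x y) z) =
      compₗ (m := m + l) habc' x
        (mapₗ (finCongr (by omega)) hr (compₗ (n := m + 1) hbc y z)) :=
  ext_valueₗ fun P φ => by
    have e1 := valueₗ_compₗ (m := m + 1) φ hab x y
    have e2 := valueₗ_compₗ (n := m + 1) φ hbc y z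
    have e3 := valueₗ_mapₗ φ (finCongr (by omega : m + 1 + l = m + l + 1)) hr
      (compₗ (n := m + 1) hbc y z)
    refine (valueₗ_mapₗ φ _ hs _).trans ?_
    refine Eq.trans ?_ (valueₗ_compₗ (m := m + l) φ habc' x _).symm
    refine (congrArg _ ((valueₗ_compₗ φ habc _ z).trans (congrArg (P.comp habc · _) e1))).trans ?_
    refine (P.comp_assoc hab habc hbc hr habc' hs _ _ _).trans ?_
    exact congrArg (P.comp (m := m + l) habc' _) (e3.trans (congrArg _ e2)).symm

/-! ### The grading -/

/-- The operations all of whose values have degree `p`. -/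
def grading (O : CyclicOperad k) (n : ℕ) (c : Fin n → Dir) (p : ℤ) :
    Submodule k (Carrier O n c) where
  carrier := {x | ∀ (P : Dioperad k) (φ : O ⟶ (LShriek k).obj P),
    valueₗ φ n c x ∈ (P.obj n c).gr p}
  add_mem' hx hy P φ := by
    rw [map_add]
    exact Submodule.add_mem _ (hx P φ) (hy P φ)
  zero_mem' P φ := by
    rw [map_zero]
    exact Submodule.zero_mem _
  smul_mem' r x hx P φ := by
    rw [map_smul]
    exact Submodule.smul_mem _ _ (hx P φ)

theorem genₗ_mem {n : ℕ} (c : Fin n → Dir) {p : ℤ} {x : O.obj n fun _ => ()}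
    (hx : x ∈ (O.obj n fun _ => ()).gr p) : genₗ c x ∈ grading O n c p :=
  fun _ φ => φ.app_mem n _ hx c trivial

theorem dₗ_mem {p : ℤ} {x : Carrier O n c} (hx : x ∈ grading O n c p) :
    dₗ O n c x ∈ grading O n c (p + 1) := fun P φ => by
  rw [valueₗ_dₗ]
  exact (P.obj n c).d_mem (hx P φ)

theorem mapₗ_mem {n m : ℕ} (σ : Fin n ≃ Fin m) {c : Fin n → Dir} {c' : Fin m → Dir}
    (h : ∀ i, c' (σ i) = c i) {p : ℤ} {x : Carrier O n c} (hx : x ∈ grading O n c p) :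
    mapₗ σ h x ∈ grading O m c' p := fun P φ => by
  rw [valueₗ_mapₗ]
  exact P.map_mem σ h (hx P φ)

theorem compₗ_mem {n m : ℕ} {a : Fin (n + 1) → Dir} {b : Fin (m + 1) → Dir}
    {c : Fin (n + m) → Dir} (h : Composable a b c) {p q : ℤ} {x : Carrier O (n + 1) a}
    {y : Carrier O (m + 1) b} (hx : x ∈ grading O _ a p) (hy : y ∈ grading O _ b q) :
    compₗ h x y ∈ grading O _ c (p + q) := fun P φ => by
  rw [valueₗ_compₗ]
  exact P.comp_mem h (hx P φ) (hy P φ)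

/-- A linear map that shifts degrees by a rule `s` preserves sums of homogeneous elements. In the
induction below `s` is the identity for generators and bijections, `· + 1` for the differential, and
`· + q` for composition with an element of degree `q`. -/
theorem iSup_le_comap {M N : Type*} [AddCommGroup M] [Module k M] [AddCommGroup N] [Module k N]
    (f : M →ₗ[k] N) {g : ℤ → Submodule k M} {g' : ℤ → Submodule k N} (s : ℤ → ℤ)
    (h : ∀ p, ∀ x ∈ g p, f x ∈ g' (s p)) : ⨆ p, g p ≤ (⨆ p, g' p).comap f :=
  iSup_le fun p x hx => Submodule.mem_iSup_of_mem (s p) (h p x hx)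

/-- Degrees are defined through values, and decomposing each value in its own `P` does not by itself
yield classes with the resulting components. The induction produces them: a generator splits because
`O` is graded, and every structure operation takes homogeneous classes to homogeneous ones. -/
theorem mk_mem_iSup_grading {n : ℕ} {c : Fin n → Dir} (t : Term O n c) :
    mk t ∈ ⨆ p, grading O n c p := by
  induction t with
  | @gen n c x =>
    have hx : x ∈ ⨆ p, (O.obj n fun _ => ()).gr p := by
      rw [(O.obj n fun _ => ()).isInternal.submodule_iSup_eq_top]
      exact Submodule.mem_top
    exact iSup_le_comap (genₗ c) id (fun p x hx => genₗ_mem c hx) hx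
  | zero c => exact Submodule.zero_mem _
  | add s t hs ht => exact Submodule.add_mem _ hs ht
  | smul r t ht => exact Submodule.smul_mem _ r ht
  | d t ht => exact iSup_le_comap (dₗ O _ _) (· + 1) (fun p x hx => dₗ_mem hx) ht
  | map σ h t ht => exact iSup_le_comap (mapₗ σ h) id (fun p x hx => mapₗ_mem σ h hx) ht
  | comp h s t hs ht =>
    -- Bilinearity is used one variable at a time: the first factor is decomposed against a
    -- homogeneous second factor, and the second factor is decomposed afterwards.
    have hst : ∀ q, ∀ y ∈ grading O _ _ q, compₗ h (mk s) y ∈ ⨆ p, grading O _ _ p :=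
      fun q y hy => iSup_le_comap ((compₗ h).flip y) (· + q)
        (fun p x hx => compₗ_mem h hx hy) hs
    exact (iSup_le fun q y hy => hst q y hy :
      ⨆ q, grading O _ _ q ≤ (⨆ p, grading O _ _ p).comap (compₗ h (mk s))) ht

theorem iSup_grading (O : CyclicOperad k) (n : ℕ) (c : Fin n → Dir) :
    ⨆ p, grading O n c p = ⊤ := by
  refine eq_top_iff.2 fun x _ => ?_
  obtain ⟨t, rfl⟩ := mk_surjective x
  exact mk_mem_iSup_grading t

/-- The sum of the components is direct because it is so in each `P`: the projection to degree `p`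
fixes the value of `x` as an element of degree `p`, and annihilates it as a sum of elements of other
degrees. Thus all values of `x` vanish. -/
theorem grading_isInternal (O : CyclicOperad k) (n : ℕ) (c : Fin n → Dir) :
    DirectSum.IsInternal (grading O n c) := by
  rw [DirectSum.isInternal_submodule_iff_iSupIndep_and_iSup_eq_top]
  refine ⟨fun p => Submodule.disjoint_def.2 fun x hx hx' => ext_valueₗ fun P φ => ?_,
    iSup_grading O n c⟩
  have hle : (⨆ j, ⨆ (_ : j ≠ p), grading O n c j) ≤
      (LinearMap.ker ((P.obj n c).proj p)).comap (valueₗ φ n c) :=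
    iSup_le fun j => iSup_le fun hj y hy => (P.obj n c).proj_of_mem_ne (hy P φ) hj
  rw [map_zero, ← (P.obj n c).proj_of_mem (hx P φ)]
  exact hle hx'

end

/-! ### The dioperad of classes and its universal property -/

/-- The dioperad `R^!(O)` generated by the operations of the cyclic operad `O` with all choices of
directions of their flags, subject to the relations that hold in all dioperads `P` with a morphism
from `O` to `L^!(P)`. -/
noncomputable def obj (O : CyclicOperad k) : Dioperad k where
  obj n c :=
    { carrier := Carrier O n c
      gr := grading O n c
      isInternal := grading_isInternal O n c
      d := dₗ O n c
      d_mem := dₗ_mem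
      d_d := fun x => ext_valueₗ fun P φ => by
        rw [valueₗ_dₗ, valueₗ_dₗ, (P.obj n c).d_d, map_zero] }
  map σ _ _ h := mapₗ σ h
  map_mem σ _ _ h _ _ hx := mapₗ_mem σ h hx
  map_d σ _ _ h x := ext_valueₗ fun P φ => by
    simp only [valueₗ_mapₗ, valueₗ_dₗ, P.map_d]
  map_refl h x := ext_valueₗ fun P φ => by rw [valueₗ_mapₗ, P.map_refl]
  map_trans σ τ _ _ _ h h' h'' x := ext_valueₗ fun P φ => by
    simp only [valueₗ_mapₗ, P.map_trans σ τ h h' h'']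
  comp h := compₗ h
  comp_mem h _ _ _ _ hx hy := compₗ_mem h hx hy
  comp_d h _ _ y hx := ext_valueₗ fun P φ => by
    simp only [map_add, map_smul, valueₗ_compₗ, valueₗ_dₗ]
    exact P.comp_d h _ (hx P φ)
  comp_map σ τ _ _ _ _ _ _ ha hb hc h h' x y := ext_valueₗ fun P φ => by
    simp only [valueₗ_compₗ, valueₗ_mapₗ]
    exact P.comp_map σ τ ha hb hc h h' _ _
  comp_comm ha hb hc h h' _ _ _ _ hx hy := ext_valueₗ fun P φ => by
    simp only [map_smul, valueₗ_compₗ, valueₗ_mapₗ]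
    exact P.comp_comm ha hb hc h h' (hx P φ) (hy P φ)
  comp_assoc hab habc hbc hr habc' hs x y z := compₗ_assoc hab habc hbc hr habc' hs x y z

/-- The morphism from `O` to `L^!(R^!(O))`. -/
noncomputable def unit (O : CyclicOperad k) : O ⟶ (LShriek k).obj (obj O) where
  app n _ := LinearMap.pi fun c => genₗ c
  app_mem n _ _ _ hx c _ := genₗ_mem c hx
  app_d n u x := funext fun c => ext_valueₗ fun P φ => by
    refine Eq.trans ?_ (valueₗ_dₗ φ (genₗ c x)).symm
    exact congrFun (φ.app_d n u x) c
  app_map σ u u' h x := funext fun c => ext_valueₗ fun P φ => by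
    refine Eq.trans ?_ (valueₗ_mapₗ φ σ (fun _ => rfl) (genₗ (fun i => c (σ i)) x)).symm
    exact congrFun (φ.app_map σ h x) c
  app_comp {n m} u u' u'' h x y := funext fun c => ext_valueₗ fun P φ => by
    -- In `L^!(R^!(O))` a composite is the sum over both directions of the new edge. That a
    -- generator given by a composite in `O` equals this sum of composites of generators can be
    -- tested under each `φ`, where it says that `φ` respects composition.
    refine (congrFun (φ.app_comp h x y) c).trans ?_
    change _ = valueₗ φ (n + m) c (∑ b : Dir, compₗ (LShriek.composable c b)
      (genₗ (LShriek.snocDir c b) x) (genₗ (LShriek.consDir c b.flip) y))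
    rw [map_sum]
    simp only [valueₗ_compₗ, valueₗ_genₗ]
    rfl

/-- The morphism from `R^!(O)` that corresponds to a morphism to `L^!(P)`. -/
noncomputable def desc {O : CyclicOperad k} {P : Dioperad k} (φ : O ⟶ (LShriek k).obj P) :
    obj O ⟶ P where
  app := valueₗ φ
  app_mem _ _ _ _ hx := hx P φ
  app_d _ _ x := valueₗ_dₗ φ x
  app_map σ _ _ h x := valueₗ_mapₗ φ σ h x
  app_comp h x y := valueₗ_compₗ φ h x y

/-- The uniqueness half of the universal property. A morphism commutes with the symbols of the
dioperad structure, so it is determined on all expressions by its values on generators, and these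
are what `unit O ≫ (LShriek k).map ψ` records. -/
theorem app_mk {O : CyclicOperad k} {P : Dioperad k} (ψ : obj O ⟶ P) {n : ℕ} {c : Fin n → Dir}
    (t : Term O n c) : ψ.app n c (mk t) = t.eval (unit O ≫ (LShriek k).map ψ) := by
  induction t with
  | gen c x => rfl
  | zero c => exact map_zero (ψ.app _ c)
  | add s t hs ht => exact (map_add (ψ.app _ _) (mk s) (mk t)).trans (congrArg₂ _ hs ht)
  | smul r t ht => exact (map_smul (ψ.app _ _) r (mk t)).trans (congrArg _ ht)
  | d t ht => exact (ψ.app_d _ _ (mk t)).trans (congrArg _ ht)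
  | map σ h t ht => exact (ψ.app_map σ h (mk t)).trans (congrArg _ ht)
  | comp h s t hs ht =>
    exact (ψ.app_comp h (mk s) (mk t)).trans (congrArg₂ (fun x y => P.comp h x y) hs ht)

/-- The universal property of `R^!(O)`. -/
noncomputable def homEquiv (O : CyclicOperad k) (P : Dioperad k) :
    (obj O ⟶ P) ≃ (O ⟶ (LShriek k).obj P) where
  toFun ψ := unit O ≫ (LShriek k).map ψ
  invFun := desc
  left_inv ψ := FlagOperad.Hom.ext <| funext fun n => funext fun c => LinearMap.ext fun x => by
    obtain ⟨t, rfl⟩ := mk_surjective x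
    exact (app_mk ψ t).symm
  -- The value of the generator with directions `c` under `φ` is by definition the component at `c`
  -- of the image under `φ`.
  right_inv _ := rfl

end RShriek

/-! ### The adjunction and the comparison of algebra structures -/

/-- A bijection for each `O` that is natural in `P` suffices: the action of the left adjoint on
morphisms is then forced. The naturality holds by computation, because the bijection is composition
with `unit O` after applying `L^!`. -/
theorem LShriek.isRightAdjoint (k : Type u) [Field k] : (LShriek k).IsRightAdjoint :=
  (Adjunction.adjunctionOfEquivLeft (G := LShriek k) RShriek.homEquiv
    fun _ _ _ _ _ => rfl).isRightAdjoint

theorem mainTheorem11 {k : Type u} [Field k] [CharZero k] (A : DGVect.{u} k)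
    (hA : A.IsFiniteType) :
    ∃ e : (LShriek k).obj (EndDi A) ≅ EndCyc A.double A.hyperbolicForm,
      (LShriek k).IsRightAdjoint ∧
      ∀ (R : CyclicOperad k ⥤ Dioperad k) (adj : R ⊣ LShriek k),
        ∃ Φ : ∀ O : CyclicOperad k,
            DioperadAlgebra (R.obj O) A ≃ CyclicAlgebra O A.double A.hyperbolicForm,
          (∀ (O : CyclicOperad k) (α : DioperadAlgebra (R.obj O) A),
            Φ O α = adj.homEquiv O (EndDi A) α ≫ e.hom) ∧
          ∀ (O O' : CyclicOperad k) (f : O ⟶ O') (α : DioperadAlgebra (R.obj O') A),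
            Φ O (R.map f ≫ α) = f ≫ Φ O' α := by
  -- The explicit `R^!` is needed only for existence. For any adjunction `R ⊣ L^!` the map `Φ` is
  -- the hom-set bijection followed by composition with `e`, so the prescribed formula is
  -- definitional, and naturality in `O` is that of the adjunction together with associativity.
  refine ⟨A.lShriekEndDiIso, LShriek.isRightAdjoint k, fun R adj =>
    ⟨fun O => (adj.homEquiv O (EndDi A)).trans A.lShriekEndDiIso.homToEquiv,
      fun O α => rfl, fun O O' f α => ?_⟩⟩
  change adj.homEquiv O (EndDi A) (R.map f ≫ α) ≫ A.lShriekEndDiIso.hom =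
    f ≫ adj.homEquiv O' (EndDi A) α ≫ A.lShriekEndDiIso.hom
  rw [adj.homEquiv_naturality_left, Category.assoc]
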